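/- **Conventions.** All vector spaces are real. For a finite-dimensional vector space $V$ let $\mathfrak d(V)=\dim V$ and $\lambda(V)=\Lambda^{\mathfrak d(V)}V$; for an isomorphism $f$, $\lambda(f)$ is the induced map. For a nonzero element $v$ of a line $L$, $v^*\in L^*$ is defined by $v^*(v)=1$. A short exact sequence $0\to V'\xrightarrow{i}V\xrightarrow{j}V''\to0$ determines $\wedge_V:\lambda(V')\otimes\lambda(V'')\to\lambda(V)$, $$v'_1\wedge\dots\wedge v'_k\otimes j(v_1)\wedge\dots\wedge j(v_l)\mapsto i(v'_1)\wedge\dots\wedge i(v'_k)\wedge v_1\wedge\dots\wedge v_l ,$$ and its value on $v'\otimes v''$ is written $\lambda(i)v'\wedge_V v''$. Let $\Omega_N=e_1\wedge\dots\wedge e_N\in\lambda(\mathbb R^N)$. For a Fredholm operator $D:X\to Y$ between Banach spaces let $\kappa(D)=\ker D$, $\mathfrak c(D)=Y/\operatorname{Im}D$, $\operatorname{ind}D=\mathfrak d(\kappa(D))-\mathfrak d(\mathfrak c(D))$ and $\lambda(D)=\lambda(\kappa(D))\otimes\lambda(\mathfrak c(D))^*$. **Exact triples.** An exact triple $\mathfrak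 t$ of Fredholm operators consists of Fredholm operators $D':X'\to Y'$, $D:X\to Y$, $D'':X''\to Y''$ between Banach spaces and of exact sequences of bounded operators $0\to X'\xrightarrow{\mathfrak i_X}X\xrightarrow{\mathfrak j_X}X''\to0$ and $0\to Y'\xrightarrow{\mathfrak i_Y}Y\xrightarrow{\mathfrak j_Y}Y''\to0$ with $\mathfrak i_YD'=D\mathfrak i_X$, $\mathfrak j_YD=D''\mathfrak j_X$. Let $\delta:\kappa(D'')\to\mathfrak c(D')$ be the connecting homomorphism of the Snake Lemma, $\delta(\mathfrak j_Xx)=y'+\operatorname{Im}D'$ if $\mathfrak i_Yy'=Dx$, and $$\epsilon_{\mathfrak t}=(\operatorname{ind}D'')\,\mathfrak d(\mathfrak c(D'))+\mathfrak d(\mathfrak c(D))\,\mathfrak d(\operatorname{Im}\delta).$$ Then $\Psi_{\mathfrak t}:\lambda(D')\otimes\lambda(D'')\to\lambda(D)$ is the unique linear map with $$\Psi_{\mathfrak t}\big(x\otimes(\lambda(\delta)v\wedge_{\mathfrak c(D')}w)^*\otimes(\lambda(\mathfrak j_X)u\wedge_{\kappa(D'')}v)\otimes(\lambda(\mathfrak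 j_Y)y)^*\big)=(-1)^{\epsilon_{\mathfrak t}}\big(\lambda(\mathfrak i_X)x\wedge_{\kappa(D)}u\big)\otimes\big(\lambda(\mathfrak i_Y)w\wedge_{\mathfrak c(D)}y\big)^*$$ for all nonzero $x\in\lambda(\kappa(D'))$, $u\in\lambda\big(\kappa(D)/\mathfrak i_X(\kappa(D'))\big)$, $v\in\lambda\big(\kappa(D'')/\mathfrak j_X(\kappa(D))\big)$, $w\in\lambda\big(\mathfrak c(D')/\delta(\kappa(D''))\big)$, $y\in\lambda\big(\mathfrak c(D)/\mathfrak i_Y(\mathfrak c(D'))\big)$. **Compositions.** For Fredholm operators $D_1:X_1\to X_2$ and $D_2:X_2\to X_3$, let $\widetilde{\mathcal C}_{D_1,D_2}:\lambda(D_1)\otimes\lambda(D_2)\to\lambda(D_2D_1)$ be $\Psi$ of the exact triple with operators $D_1$, $D_2D_1\oplus\mathrm{id}_{X_2}:X_1\oplus X_2\to X_3\oplus X_2$, $D_2$ and with maps $\mathfrak i_X(x_1)=(x_1,D_1x_1)$, $\mathfrak j_X(x_1,x_2)=D_1x_1-x_2$, $\mathfrak i_Y(x_2)=(D_2x_2,x_2)$,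 $\mathfrak j_Y(x_3,x_2)=x_3-D_2x_2$, followed by the identification $\lambda(D_2D_1\oplus\mathrm{id}_{X_2})=\lambda(D_2D_1)$ induced by $\kappa(D_2D_1)\ni x\leftrightarrow(x,0)$ and $[y]\leftrightarrow[(y,0)]$ on the cokernels. **Stabilizations.** For a Fredholm operator $D:X\to Y$ and a homomorphism $\Theta:\mathbb R^N\to Y$ let $D_\Theta:X\oplus\mathbb R^N\to Y$, $D_\Theta(x,u)=Dx+\Theta u$, let $\iota_{X;N}:X\to X\oplus\mathbb R^N$ be the inclusion and $\pi_2:\mathfrak c(\iota_{X;N})\to\mathbb R^N$ the isomorphism induced by the projection. Since $D=D_\Theta\circ\iota_{X;N}$, we can define $$\mathcal I_{\Theta;D}:\lambda(D_\Theta)\to\lambda(D),\qquad \mathcal I_{\Theta;D}(\sigma)=\widetilde{\mathcal C}_{\iota_{X;N},D_\Theta}\big(1\otimes(\Omega_N^*\circ\lambda(\pi_2))\otimes\sigma\big).$$ **Statement.** Let $\mathfrak t$ be an exact triple of Fredholm operators as above. Let $\mathfrak s$ consist of homomorphisms $\Theta':\mathbb R^{N'}\to Y'$, $\Theta:\mathbb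 R^N\to Y$, $\Theta'':\mathbb R^{N''}\to Y''$ and of an exact sequence $0\to\mathbb R^{N'}\xrightarrow{\mathfrak i}\mathbb R^N\xrightarrow{\mathfrak j}\mathbb R^{N''}\to0$ with $\mathfrak i_Y\Theta'=\Theta\mathfrak i$ and $\mathfrak j_Y\Theta=\Theta''\mathfrak j$. Define $A_{\mathfrak s}\in\mathbb R^*$ by $\lambda(\mathfrak i)\Omega_{N'}\wedge_{\mathbb R^N}\Omega_{N''}=A_{\mathfrak s}\Omega_N$, and let $\mathfrak t_{\mathfrak s}$ be the exact triple with operators $D'_{\Theta'},D_\Theta,D''_{\Theta''}$, top row $0\to X'\oplus\mathbb R^{N'}\xrightarrow{\mathfrak i_X\oplus\mathfrak i}X\oplus\mathbb R^N\xrightarrow{\mathfrak j_X\oplus\mathfrak j}X''\oplus\mathbb R^{N''}\to0$ and bottom row $0\to Y'\xrightarrow{\mathfrak i_Y}Y\xrightarrow{\mathfrak j_Y}Y''\to0$. Then $$\mathcal I_{\Theta;D}\circ\Psi_{\mathfrak t_{\mathfrak s}}=(-1)^{(\operatorname{ind}D')N''}A_{\mathfrak s}\;\Psi_{\mathfrak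 t}\circ\big(\mathcal I_{\Theta';D'}\otimes\mathcal I_{\Theta'';D''}\big)$$ as maps $\lambda(D'_{\Theta'})\otimes\lambda(D''_{\Theta''})\to\lambda(D)$. -/

import Mathlib

open scoped TensorProduct

namespace FredDet

section Algebra

/-! ### Top exterior powers -/

/-- The top exterior power `λ(V) = Λ^{dim V} V` of a (finite-dimensional) real vector space. -/
abbrev Lam (V : Type*) [AddCommGroup V] [Module ℝ V] : Type _ :=
  ↥(⋀[ℝ]^(Module.finrank ℝ V) V)

variable {V V' V'' W : Type*} [AddCommGroup V] [Module ℝ V] [AddCommGroup V'] [Module ℝ V']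
  [AddCommGroup V''] [Module ℝ V''] [AddCommGroup W] [Module ℝ W]

/-- The map `λ(e) : λ(V) → λ(W)`, `v₁ ∧ … ∧ v_k ↦ e v₁ ∧ … ∧ e v_k`, of an isomorphism `e`. -/
noncomputable def lamMap (e : V ≃ₗ[ℝ] W) : Lam V →ₗ[ℝ] Lam W :=
  (LinearEquiv.ofEq (⋀[ℝ]^(Module.finrank ℝ V) W) (⋀[ℝ]^(Module.finrank ℝ W) W)
      (by rw [e.finrank_eq])).toLinearMap ∘ₗ
    exteriorPower.map (Module.finrank ℝ V) e.toLinearMap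

theorem lamMap_injective (e : V ≃ₗ[ℝ] W) : Function.Injective (lamMap e) :=
  ((LinearEquiv.ofEq (⋀[ℝ]^(Module.finrank ℝ V) W) (⋀[ℝ]^(Module.finrank ℝ W) W)
    (by rw [e.finrank_eq])).injective).comp
    (exteriorPower.map_injective_field (LinearMap.ker_eq_bot.1 e.ker))

theorem exists_dual_one (v : V) (hv : v ≠ 0) : ∃ α : Module.Dual ℝ V, α v = 1 :=
  Module.Projective.exists_dual_eq_one ℝ hv

open Classical in
/-- For a nonzero element `v` of a line, the element `v^*` of the dual line with `v^*(v) = 1`. -/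
noncomputable def dualElt (v : V) : Module.Dual ℝ V :=
  if hv : v = 0 then 0 else (exists_dual_one v hv).choose

theorem dualElt_self {v : V} (hv : v ≠ 0) : dualElt v v = 1 := by
  rw [dualElt, dif_neg hv]
  exact (exists_dual_one v hv).choose_spec

theorem eq_smul_of_line (hV : Module.finrank ℝ V = 1) {v : V} (hv : v ≠ 0) (w : V) :
    ∃ c : ℝ, w = c • v := by
  obtain ⟨c, hc⟩ := exists_smul_eq_of_finrank_eq_one hV hv w
  exact ⟨c, hc.symm⟩

theorem exists_ne_zero_of_line (hV : Module.finrank ℝ V = 1) : ∃ v : V, v ≠ 0 := by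
  have : Nontrivial V := Module.nontrivial_of_finrank_pos (R := ℝ) (by omega)
  exact exists_ne 0

theorem dualElt_unique (hV : Module.finrank ℝ V = 1) {v : V} (α : Module.Dual ℝ V)
    (h : α v = 1) : α = dualElt v := by
  have hv : v ≠ 0 := by rintro rfl; simp at h
  ext w
  obtain ⟨c, rfl⟩ := eq_smul_of_line hV hv w
  simp [h, dualElt_self hv]

theorem dualElt_smul (hV : Module.finrank ℝ V = 1) {v : V} (hv : v ≠ 0) {c : ℝ} (hc : c ≠ 0) :
    dualElt (c • v) = c⁻¹ • dualElt v := by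
  symm
  apply dualElt_unique hV
  simp [dualElt_self hv, hc]

theorem tmul_ne_zero {v : V} {w : W} (hv : v ≠ 0) (hw : w ≠ 0) : v ⊗ₜ[ℝ] w ≠ 0 := by
  intro h0
  have := congrArg ((TensorProduct.lid ℝ ℝ).toLinearMap ∘ₗ
    TensorProduct.map (dualElt v) (dualElt w)) h0
  simp [dualElt_self hv, dualElt_self hw] at this

theorem dualElt_ne_zero {v : V} (hv : v ≠ 0) : dualElt v ≠ 0 := by
  intro h
  have := dualElt_self hv
  simp [h] at this

/-- A formula that is homogeneous in generators of lines determines a unique linear map. -/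
theorem existsUnique_of_lines {P Q R S T U A B C E : Type*}
    [AddCommGroup P] [Module ℝ P] [AddCommGroup Q] [Module ℝ Q] [AddCommGroup R] [Module ℝ R]
    [AddCommGroup S] [Module ℝ S] [AddCommGroup T] [Module ℝ T] [AddCommGroup U] [Module ℝ U]
    [AddCommGroup A] [Module ℝ A] [AddCommGroup B] [Module ℝ B] [AddCommGroup C] [Module ℝ C]
    [AddCommGroup E] [Module ℝ E]
    (hP : Module.finrank ℝ P = 1) (hQ : Module.finrank ℝ Q = 1) (hR : Module.finrank ℝ R = 1)
    (hS : Module.finrank ℝ S = 1) (hU : Module.finrank ℝ U = 1) (hA : Module.finrank ℝ A = 1)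
    (hB : Module.finrank ℝ B = 1) (hC : Module.finrank ℝ C = 1) (hE : Module.finrank ℝ E = 1)
    (f1 : B →ₗ[ℝ] C →ₗ[ℝ] Q) (f2 : A →ₗ[ℝ] B →ₗ[ℝ] R) (f3 : P →ₗ[ℝ] A →ₗ[ℝ] T)
    (f4 : C →ₗ[ℝ] E →ₗ[ℝ] U) (g : E →ₗ[ℝ] S) (s : ℝ)
    (n1 : ∀ {b c}, b ≠ 0 → c ≠ 0 → f1 b c ≠ 0) (n2 : ∀ {b c}, b ≠ 0 → c ≠ 0 → f2 b c ≠ 0)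
    (n4 : ∀ {b c}, b ≠ 0 → c ≠ 0 → f4 b c ≠ 0) (ng : Function.Injective g) :
    ∃! Ψ : (P ⊗[ℝ] Module.Dual ℝ Q) ⊗[ℝ] (R ⊗[ℝ] Module.Dual ℝ S) →ₗ[ℝ]
        T ⊗[ℝ] Module.Dual ℝ U,
      ∀ x u v w y, x ≠ 0 → u ≠ 0 → v ≠ 0 → w ≠ 0 → y ≠ 0 →
        Ψ ((x ⊗ₜ dualElt (f1 v w)) ⊗ₜ (f2 u v ⊗ₜ dualElt (g y))) =
          s • (f3 x u ⊗ₜ dualElt (f4 w y)) := by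
  obtain ⟨x, hx⟩ := exists_ne_zero_of_line hP
  obtain ⟨u, hu⟩ := exists_ne_zero_of_line hA
  obtain ⟨v, hv⟩ := exists_ne_zero_of_line hB
  obtain ⟨w, hw⟩ := exists_ne_zero_of_line hC
  obtain ⟨y, hy⟩ := exists_ne_zero_of_line hE
  have hjy : g y ≠ 0 := by
    rwa [Ne, ng.eq_iff' (map_zero _)]
  set e : (P ⊗[ℝ] Module.Dual ℝ Q) ⊗[ℝ] (R ⊗[ℝ] Module.Dual ℝ S) :=
    (x ⊗ₜ dualElt (f1 v w)) ⊗ₜ (f2 u v ⊗ₜ dualElt (g y)) with he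
  have hline : Module.finrank ℝ
      ((P ⊗[ℝ] Module.Dual ℝ Q) ⊗[ℝ] (R ⊗[ℝ] Module.Dual ℝ S)) = 1 := by
    simp [Module.finrank_tensorProduct, Subspace.dual_finrank_eq, hP, hQ, hR, hS]
  have he0 : e ≠ 0 := tmul_ne_zero (tmul_ne_zero hx (dualElt_ne_zero (n1 hv hw)))
    (tmul_ne_zero (n2 hu hv) (dualElt_ne_zero hjy))
  refine ⟨(dualElt e).smulRight (s • (f3 x u ⊗ₜ dualElt (f4 w y))), ?_, ?_⟩
  · intro x1 u1 v1 w1 y1 hx1 hu1 hv1 hw1 hy1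
    obtain ⟨a, rfl⟩ := eq_smul_of_line hP hx x1
    obtain ⟨b, rfl⟩ := eq_smul_of_line hA hu u1
    obtain ⟨c, rfl⟩ := eq_smul_of_line hB hv v1
    obtain ⟨d, rfl⟩ := eq_smul_of_line hC hw w1
    obtain ⟨f, rfl⟩ := eq_smul_of_line hE hy y1
    have hc := left_ne_zero_of_smul hv1
    have hd := left_ne_zero_of_smul hw1
    have hf := left_ne_zero_of_smul hy1
    have h1 : f1 (c • v) (d • w) = (c * d) • f1 v w := by simp [smul_smul, mul_comm]
    have h2 : f2 (b • u) (c • v) = (b * c) • f2 u v := by simp [smul_smul, mul_comm]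
    have h3 : f3 (a • x) (b • u) = (a * b) • f3 x u := by simp [smul_smul, mul_comm]
    have h4 : f4 (d • w) (f • y) = (d * f) • f4 w y := by simp [smul_smul, mul_comm]
    have h5 : ((a • x) ⊗ₜ[ℝ] dualElt (f1 (c • v) (d • w))) ⊗ₜ[ℝ]
        (f2 (b • u) (c • v) ⊗ₜ[ℝ] dualElt (g (f • y))) = (a * b * d⁻¹ * f⁻¹) • e := by
      rw [h1, h2, map_smul, dualElt_smul hQ (n1 hv hw) (mul_ne_zero hc hd), dualElt_smul hS hjy hf]
      simp only [← TensorProduct.smul_tmul', TensorProduct.tmul_smul, smul_smul, he]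
      congr 1
      field_simp
    rw [h5, h3, h4, dualElt_smul hU (n4 hw hy) (mul_ne_zero hd hf)]
    simp only [← TensorProduct.smul_tmul', TensorProduct.tmul_smul, smul_smul, map_smul,
      LinearMap.smulRight_apply, dualElt_self he0]
    congr 1
    field_simp
  · intro Ψ hΨ
    refine LinearMap.ext fun z => ?_
    obtain ⟨c, rfl⟩ := eq_smul_of_line hline he0 z
    rw [map_smul, map_smul, hΨ x u v w y hx hu hv hw hy, LinearMap.smulRight_apply,
      dualElt_self he0, one_smul]

theorem finrank_lam [FiniteDimensional ℝ V] : Module.finrank ℝ (Lam V) = 1 := by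
  rw [exteriorPower.finrank_eq, Nat.choose_self]

/-- A short exact sequence `0 → V' → V → V'' → 0` of vector spaces. -/
structure IsSES (i : V' →ₗ[ℝ] V) (j : V →ₗ[ℝ] V'') : Prop where
  inj : Function.Injective i
  exact : Function.Exact i j
  surj : Function.Surjective j

namespace IsSES

variable {i : V' →ₗ[ℝ] V} {j : V →ₗ[ℝ] V''}

/-- A linear section of the surjection in a short exact sequence. -/
noncomputable def lift (h : IsSES i j) : V'' →ₗ[ℝ] V :=
  (j.exists_rightInverse_of_surjective (LinearMap.range_eq_top.2 h.surj)).choose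

theorem section_spec (h : IsSES i j) (x : V'') : j (h.lift x) = x :=
  LinearMap.congr_fun
    (j.exists_rightInverse_of_surjective (LinearMap.range_eq_top.2 h.surj)).choose_spec x

/-- The splitting `V' × V'' ≃ V` given by the section. -/
noncomputable def splitting (h : IsSES i j) : (V' × V'') ≃ₗ[ℝ] V :=
  LinearEquiv.ofBijective (i.coprod h.lift) (by
    constructor
    · rw [injective_iff_map_eq_zero]
      rintro ⟨a, b⟩ hab
      simp only [LinearMap.coprod_apply] at hab
      have hb : b = 0 := by
        have := congrArg j hab
        simpa [h.exact.apply_apply_eq_zero, h.section_spec] using this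
      subst hb
      simp only [map_zero, add_zero] at hab
      have ha : a = 0 := h.inj (by simpa using hab)
      simp [ha]
    · intro x
      obtain ⟨a, ha⟩ := (h.exact (x - h.lift (j x))).1 (by simp [h.section_spec])
      exact ⟨(a, j x), by simp [ha]⟩)

theorem splitting_apply (h : IsSES i j) (p : V' × V'') :
    h.splitting p = i p.1 + h.lift p.2 := rfl

theorem finrank_eq (h : IsSES i j) [FiniteDimensional ℝ V] :
    Module.finrank ℝ V' + Module.finrank ℝ V'' = Module.finrank ℝ V := by
  have : FiniteDimensional ℝ V' := Module.Finite.of_injective i h.inj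
  have : FiniteDimensional ℝ V'' := Module.Finite.of_surjective j h.surj
  rw [← h.splitting.finrank_eq, Module.finrank_prod]

/-- The bilinear map underlying the isomorphism `∧_V : λ(V') ⊗ λ(V'') → λ(V)` of a short exact
sequence:
`(v'₁ ∧ … ∧ v'_k) ∧_V (j v₁ ∧ … ∧ j v_l) = i v'₁ ∧ … ∧ i v'_k ∧ v₁ ∧ … ∧ v_l`.
The lifts of the vectors of `V''` to `V` are taken by a linear section of `j`; the result does not
depend on the section, since `λ(V')` is the top exterior power. -/
noncomputable def wedge (h : IsSES i j) [FiniteDimensional ℝ V] :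
    Lam V' →ₗ[ℝ] Lam V'' →ₗ[ℝ] Lam V :=
  LinearMap.mk₂ ℝ
    (fun a b => ⟨(exteriorPower.map (Module.finrank ℝ V') i a).1 *
        (exteriorPower.map (Module.finrank ℝ V'') h.lift b).1, by
      rw [← h.finrank_eq]
      exact SetLike.mul_mem_graded (A := fun n : ℕ => ⋀[ℝ]^n V)
        (exteriorPower.map (Module.finrank ℝ V') i a).2
        (exteriorPower.map (Module.finrank ℝ V'') h.lift b).2⟩)
    (fun a a' b => Subtype.ext (by simp [add_mul]))
    (fun c a b => Subtype.ext (by simp))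
    (fun a b b' => Subtype.ext (by simp [mul_add]))
    (fun c a b => Subtype.ext (by simp))

theorem ι_mul_ιMulti {V : Type*} [AddCommGroup V] [Module ℝ V] (b : V) (k : ℕ) (f : Fin k → V) :
    ExteriorAlgebra.ι ℝ b * ExteriorAlgebra.ιMulti ℝ k f =
      (-1 : ℝ) ^ k • (ExteriorAlgebra.ιMulti ℝ k f * ExteriorAlgebra.ι ℝ b) := by
  induction k with
  | zero => simp
  | succ k ih =>
    rw [ExteriorAlgebra.ιMulti_succ_apply, ← mul_assoc,
      eq_neg_of_add_eq_zero_left (ExteriorAlgebra.ι_add_mul_swap b (f 0)), neg_mul, mul_assoc, ih,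
      mul_smul_comm, pow_succ, mul_assoc]
    simp

/-- The defining formula of `∧_V`, with arbitrary lifts `v` of the vectors of `V''`. -/
theorem wedge_ιMulti (h : IsSES i j) [FiniteDimensional ℝ V]
    (v' : Fin (Module.finrank ℝ V') → V') (v : Fin (Module.finrank ℝ V'') → V) :
    (h.wedge (exteriorPower.ιMulti ℝ _ v') (exteriorPower.ιMulti ℝ _ (j ∘ v))).1 =
      ExteriorAlgebra.ιMulti ℝ _ (Fin.append (i ∘ v') v) := by
  have : FiniteDimensional ℝ V' := Module.Finite.of_injective i h.inj
  have key : ∀ (l : ℕ) (v : Fin l → V),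
      ExteriorAlgebra.ιMulti ℝ _ (i ∘ v') * ExteriorAlgebra.ιMulti ℝ l (h.lift ∘ j ∘ v) =
        ExteriorAlgebra.ιMulti ℝ _ (i ∘ v') * ExteriorAlgebra.ιMulti ℝ l v := by
    intro l
    induction l with
    | zero => intro v; simp
    | succ l ih =>
      intro v
      obtain ⟨a, ha⟩ := (h.exact (v 0 - h.lift (j (v 0)))).1 (by simp [h.section_spec])
      have hv : v 0 = h.lift (j (v 0)) + i a := by rw [ha]; abel
      have hz : ExteriorAlgebra.ιMulti ℝ _ (i ∘ v') * ExteriorAlgebra.ι ℝ (i a) = 0 := by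
        have h1 : (ExteriorAlgebra.ι ℝ (i a) : ExteriorAlgebra ℝ V) =
            ExteriorAlgebra.ιMulti ℝ 1 (i ∘ fun _ => a) := by simp
        have h2 : Fin.append (i ∘ v') (i ∘ fun _ : Fin 1 => a) =
            i ∘ Fin.append v' (fun _ : Fin 1 => a) := by
          funext k
          refine Fin.addCases (fun k => ?_) (fun k => ?_) k <;> simp
        rw [h1, ExteriorAlgebra.ιMulti_mul_ιMulti, h2, ← ExteriorAlgebra.map_apply_ιMulti,
          AlternatingMap.map_linearDependent, map_zero]
        intro hli
        have := hli.fintype_card_le_finrank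
        simp at this
      have hc : ∀ b, ExteriorAlgebra.ιMulti ℝ _ (i ∘ v') * ExteriorAlgebra.ι ℝ b =
          (-1 : ℝ) ^ (Module.finrank ℝ V') •
            (ExteriorAlgebra.ι ℝ b * ExteriorAlgebra.ιMulti ℝ _ (i ∘ v')) := by
        intro b
        rw [ι_mul_ιMulti, smul_smul, ← mul_pow]
        simp
      rw [ExteriorAlgebra.ιMulti_succ_apply, ExteriorAlgebra.ιMulti_succ_apply (v := v),
        ← mul_assoc, ← mul_assoc, hv, map_add, mul_add, hz, add_zero]
      have ih' := ih (Matrix.vecTail v)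
      change _ * ExteriorAlgebra.ι ℝ (h.lift (j (v 0))) *
        ExteriorAlgebra.ιMulti ℝ l (h.lift ∘ j ∘ Matrix.vecTail v) = _
      rw [hc, smul_mul_assoc, smul_mul_assoc, mul_assoc, mul_assoc, ih']
  simp only [wedge, LinearMap.mk₂_apply, exteriorPower.map_apply_ιMulti,
    exteriorPower.ιMulti_apply_coe]
  rw [key, ExteriorAlgebra.ιMulti_mul_ιMulti]

theorem wedge_ne_zero (h : IsSES i j) [FiniteDimensional ℝ V] {a : Lam V'} {b : Lam V''}
    (ha : a ≠ 0) (hb : b ≠ 0) : h.wedge a b ≠ 0 := by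
  have : FiniteDimensional ℝ V' := Module.Finite.of_injective i h.inj
  have : FiniteDimensional ℝ V'' := Module.Finite.of_surjective j h.surj
  let b' := Module.finBasis ℝ V'
  let b'' := Module.finBasis ℝ V''
  let B : Module.Basis (Fin (Module.finrank ℝ V' + Module.finrank ℝ V'')) ℝ V :=
    ((b'.prod b'').map h.splitting).reindex finSumFinEquiv
  have hB : Fin.append (i ∘ b') (h.lift ∘ b'') = B := by
    funext k
    refine Fin.addCases (fun k => ?_) (fun k => ?_) k
    · simp [B, h.splitting_apply]
    · simp [B, h.splitting_apply]
  intro h0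
  obtain ⟨c, hc⟩ := eq_smul_of_line finrank_lam ha (exteriorPower.ιMulti ℝ _ b')
  obtain ⟨d, hd⟩ := eq_smul_of_line finrank_lam hb (exteriorPower.ιMulti ℝ _ b'')
  have h1 : h.wedge (exteriorPower.ιMulti ℝ _ b') (exteriorPower.ιMulti ℝ _ b'') = 0 := by
    rw [hc, hd]; simp [h0]
  have h2 : ExteriorAlgebra.ιMulti ℝ _ (B : _ → V) = 0 := by
    have := congrArg Subtype.val h1
    simp only [wedge, LinearMap.mk₂_apply, exteriorPower.map_apply_ιMulti,
      exteriorPower.ιMulti_apply_coe, ExteriorAlgebra.ιMulti_mul_ιMulti, hB] at this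
    exact this
  have h3 : exteriorPower.ιMulti ℝ _ (B : _ → V) = 0 := Subtype.ext h2
  have h4 := exteriorPower.alternatingMapLinearEquiv_apply_ιMulti B.det B
  rw [h3, map_zero, B.det_self] at h4
  exact zero_ne_one h4

end IsSES

/-- For an exact sequence `A → B → C`, the injection `B / im f → C` induced by `g`. -/
noncomputable def bar (f : V' →ₗ[ℝ] V) (g : V →ₗ[ℝ] V'') (h : Function.Exact f g) :
    (V ⧸ LinearMap.range f) →ₗ[ℝ] V'' :=
  (LinearMap.range f).liftQ g (by rw [h.linearMap_ker_eq])

theorem bar_injective {f : V' →ₗ[ℝ] V} {g : V →ₗ[ℝ] V''} (h : Function.Exact f g) :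
    Function.Injective (bar f g h) := by
  rw [← LinearMap.ker_eq_bot]
  exact Submodule.ker_liftQ_eq_bot _ _ _ (by rw [h.linearMap_ker_eq])

/-- For an exact sequence `A → B → C`, the short exact sequence
`0 → B / im f → C → C / im g → 0`. -/
theorem isSES_bar {f : V' →ₗ[ℝ] V} {g : V →ₗ[ℝ] V''} (h : Function.Exact f g) :
    IsSES (bar f g h) (LinearMap.range g).mkQ where
  inj := bar_injective h
  exact := by
    rw [LinearMap.exact_iff, Submodule.ker_mkQ, bar, Submodule.range_liftQ]
  surj := Submodule.mkQ_surjective _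

/-- The short exact sequence `0 → A → B → B / im f → 0` of an injection. -/
theorem isSES_mkQ {f : V' →ₗ[ℝ] V} (h : Function.Injective f) :
    IsSES f (LinearMap.range f).mkQ where
  inj := h
  exact := by rw [LinearMap.exact_iff, Submodule.ker_mkQ]
  surj := Submodule.mkQ_surjective _

end Algebra

section Fredholm

open ContinuousLinearMap

variable {X Y : Type*} [NormedAddCommGroup X] [NormedSpace ℝ X]
  [NormedAddCommGroup Y] [NormedSpace ℝ Y]

/-! ### Fredholm operators and their determinant lines -/

/-- The kernel `κ(D)`. -/
abbrev Ker (D : X →L[ℝ] Y) : Type _ := ↥(LinearMap.ker D.toLinearMap)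

/-- The cokernel `𝔠(D) = Y / im D`. -/
abbrev Coker (D : X →L[ℝ] Y) : Type _ := Y ⧸ LinearMap.range D.toLinearMap

/-- The index `ind D = dim κ(D) - dim 𝔠(D)`. -/
noncomputable def ind (D : X →L[ℝ] Y) : ℤ :=
  (Module.finrank ℝ (Ker D) : ℤ) - Module.finrank ℝ (Coker D)

/-- The determinant line `λ(D) = λ(κ(D)) ⊗ λ(𝔠(D))^*`. -/
abbrev DetLine (D : X →L[ℝ] Y) : Type _ :=
  Lam (Ker D) ⊗[ℝ] Module.Dual ℝ (Lam (Coker D))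

theorem finrank_detLine {D : X →L[ℝ] Y} (hD : D.IsFredholm) :
    Module.finrank ℝ (DetLine D) = 1 := by
  have : FiniteDimensional ℝ (Ker D) := hD.finite_ker
  have : FiniteDimensional ℝ (Coker D) := hD.finite_coker
  rw [Module.finrank_tensorProduct, Subspace.dual_finrank_eq, finrank_lam, finrank_lam]

end Fredholm

section Triple

/-! ### Exact triples of Fredholm operators -/

/-- An exact triple of Fredholm operators: a commutative diagram
```
0 → X' -iX→ X -jX→ X'' → 0
    |D'     |D     |D''
0 → Y' -iY→ Y -jY→ Y'' → 0
```
of bounded operators with exact rows and with Fredholm operators `D'`, `D`, `D''`. -/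
structure FredTriple (X' X X'' Y' Y Y'' : Type*)
    [NormedAddCommGroup X'] [NormedSpace ℝ X'] [NormedAddCommGroup X] [NormedSpace ℝ X]
    [NormedAddCommGroup X''] [NormedSpace ℝ X''] [NormedAddCommGroup Y'] [NormedSpace ℝ Y']
    [NormedAddCommGroup Y] [NormedSpace ℝ Y] [NormedAddCommGroup Y''] [NormedSpace ℝ Y''] where
  D' : X' →L[ℝ] Y'
  D : X →L[ℝ] Y
  D'' : X'' →L[ℝ] Y''
  fredholm' : D'.IsFredholm
  fredholm : D.IsFredholm
  fredholm'' : D''.IsFredholm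
  iX : X' →L[ℝ] X
  jX : X →L[ℝ] X''
  iY : Y' →L[ℝ] Y
  jY : Y →L[ℝ] Y''
  sesX : IsSES iX.toLinearMap jX.toLinearMap
  sesY : IsSES iY.toLinearMap jY.toLinearMap
  comm_i : iY ∘L D' = D ∘L iX
  comm_j : jY ∘L D = D'' ∘L jX

namespace FredTriple

variable {X' X X'' Y' Y Y'' : Type*}
  [NormedAddCommGroup X'] [NormedSpace ℝ X'] [NormedAddCommGroup X] [NormedSpace ℝ X]
  [NormedAddCommGroup X''] [NormedSpace ℝ X''] [NormedAddCommGroup Y'] [NormedSpace ℝ Y']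
  [NormedAddCommGroup Y] [NormedSpace ℝ Y] [NormedAddCommGroup Y''] [NormedSpace ℝ Y'']
  (t : FredTriple X' X X'' Y' Y Y'')

instance : FiniteDimensional ℝ (Ker t.D') := t.fredholm'.finite_ker
instance : FiniteDimensional ℝ (Ker t.D) := t.fredholm.finite_ker
instance : FiniteDimensional ℝ (Ker t.D'') := t.fredholm''.finite_ker
instance : FiniteDimensional ℝ (Coker t.D') := t.fredholm'.finite_coker
instance : FiniteDimensional ℝ (Coker t.D) := t.fredholm.finite_coker
instance : FiniteDimensional ℝ (Coker t.D'') := t.fredholm''.finite_coker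

theorem comm_i_apply (x : X') : t.iY (t.D' x) = t.D (t.iX x) :=
  DFunLike.congr_fun t.comm_i x

theorem comm_j_apply (x : X) : t.jY (t.D x) = t.D'' (t.jX x) :=
  DFunLike.congr_fun t.comm_j x

/-- `iX : κ(D') → κ(D)`. -/
noncomputable def kerI : Ker t.D' →ₗ[ℝ] Ker t.D :=
  t.iX.toLinearMap.restrict fun x (hx : t.D' x = 0) => by
    simp [← t.comm_i_apply, hx]

/-- `jX : κ(D) → κ(D'')`. -/
noncomputable def kerJ : Ker t.D →ₗ[ℝ] Ker t.D'' :=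
  t.jX.toLinearMap.restrict fun x (hx : t.D x = 0) => by
    simp [← t.comm_j_apply, hx]

/-- `iY : 𝔠(D') → 𝔠(D)`. -/
noncomputable def cokI : Coker t.D' →ₗ[ℝ] Coker t.D :=
  Submodule.mapQ _ _ t.iY.toLinearMap (by
    rintro _ ⟨x, rfl⟩
    exact ⟨t.iX x, (t.comm_i_apply x).symm⟩)

/-- `jY : 𝔠(D) → 𝔠(D'')`. -/
noncomputable def cokJ : Coker t.D →ₗ[ℝ] Coker t.D'' :=
  Submodule.mapQ _ _ t.jY.toLinearMap (by
    rintro _ ⟨x, rfl⟩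
    exact ⟨t.jX x, (t.comm_j_apply x).symm⟩)

/-- The connecting homomorphism `δ : κ(D'') → 𝔠(D')` of the Snake Lemma,
`δ(jX x) = y' + im D'` if `iY y' = D x`. -/
noncomputable def delta : Ker t.D'' →ₗ[ℝ] Coker t.D' :=
  SnakeLemma.δ' t.D'.toLinearMap t.D.toLinearMap t.D''.toLinearMap
    t.iX.toLinearMap t.jX.toLinearMap t.sesX.exact t.iY.toLinearMap t.jY.toLinearMap t.sesY.exact
    (congrArg ContinuousLinearMap.toLinearMap t.comm_i)
    (congrArg ContinuousLinearMap.toLinearMap t.comm_j)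
    (LinearMap.ker t.D''.toLinearMap).subtype
    (LinearMap.exact_subtype_ker_map _)
    (LinearMap.range t.D'.toLinearMap).mkQ
    (LinearMap.exact_map_mkQ_range _) t.sesX.surj t.sesY.inj

/-! The six-term exact sequence
`0 → κ(D') → κ(D) → κ(D'') → 𝔠(D') → 𝔠(D) → 𝔠(D'') → 0`. -/

theorem kerI_injective : Function.Injective t.kerI := fun _ _ h =>
  Subtype.ext (t.sesX.inj (congrArg Subtype.val h))

theorem exact_ker : Function.Exact t.kerI t.kerJ := by
  intro x
  constructor
  · intro h
    obtain ⟨y, hy⟩ := (t.sesX.exact x.1).1 (congrArg Subtype.val h)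
    refine ⟨⟨y, ?_⟩, Subtype.ext hy⟩
    rw [LinearMap.mem_ker]
    apply t.sesY.inj
    have h2 : t.D x.1 = 0 := x.2
    have h3 := t.comm_i_apply y
    have hy' : t.iX y = x.1 := hy
    rw [hy', h2] at h3
    simpa using h3
  · rintro ⟨y, rfl⟩
    exact Subtype.ext (t.sesX.exact.apply_apply_eq_zero y.1)

theorem exact_kerJ_delta : Function.Exact t.kerJ t.delta :=
  SnakeLemma.exact_δ'_right _ _ _ _ _ _ _ _ _ _ _
    (LinearMap.ker t.D.toLinearMap).subtype (LinearMap.exact_subtype_ker_map _) _ _ _ _ _ _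
    t.kerJ rfl (Submodule.subtype_injective _)

theorem exact_delta_cokI : Function.Exact t.delta t.cokI :=
  SnakeLemma.exact_δ'_left _ _ _ _ _ _ _ _ _ _ _ _ _ _ _
    (LinearMap.range t.D.toLinearMap).mkQ (LinearMap.exact_map_mkQ_range _) _ _
    t.cokI rfl (Submodule.mkQ_surjective _)

theorem exact_cok : Function.Exact t.cokI t.cokJ := by
  intro y
  induction y using Submodule.Quotient.induction_on with
  | _ y =>
  constructor
  · intro h
    have h1 : (Submodule.Quotient.mk (t.jY y) : Coker t.D'') = 0 := h
    rw [Submodule.Quotient.mk_eq_zero] at h1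
    obtain ⟨x'', hx''⟩ := h1
    obtain ⟨x, rfl⟩ := t.sesX.surj x''
    have h2 : t.jY (y - t.D x) = 0 := by
      rw [map_sub, t.comm_j_apply, sub_eq_zero]
      exact hx''.symm
    obtain ⟨y', hy'⟩ := (t.sesY.exact _).1 h2
    refine ⟨Submodule.Quotient.mk y', ?_⟩
    change (Submodule.Quotient.mk (t.iY y') : Coker t.D) = Submodule.Quotient.mk y
    rw [Submodule.Quotient.eq]
    have hy'' : t.iY y' = y - t.D x := hy'
    exact ⟨-x, by simp [hy'']⟩
  · rintro ⟨y', h⟩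
    induction y' using Submodule.Quotient.induction_on with
    | _ y' =>
    rw [← h]
    change (Submodule.Quotient.mk (t.jY (t.iY y')) : Coker t.D'') = 0
    have : t.jY (t.iY y') = 0 := t.sesY.exact.apply_apply_eq_zero y'
    rw [this, Submodule.Quotient.mk_zero]

theorem cokJ_surjective : Function.Surjective t.cokJ := by
  intro y
  induction y using Submodule.Quotient.induction_on with
  | _ y =>
  obtain ⟨y, rfl⟩ := t.sesY.surj y
  exact ⟨Submodule.Quotient.mk y, rfl⟩

/-- The isomorphism `𝔠(D) / iY(𝔠(D')) ≃ 𝔠(D'')` induced by `jY`. -/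
noncomputable def cokEquiv :
    (Coker t.D ⧸ LinearMap.range t.cokI) ≃ₗ[ℝ] Coker t.D'' :=
  LinearEquiv.ofBijective (bar t.cokI t.cokJ t.exact_cok) ⟨bar_injective _, fun y => by
    obtain ⟨x, hx⟩ := t.cokJ_surjective y
    exact ⟨Submodule.Quotient.mk x, hx⟩⟩

/-- The sign exponent `ε_t = (ind D'') dim 𝔠(D') + dim 𝔠(D) dim (im δ)`. -/
noncomputable def eps : ℤ :=
  ind t.D'' * Module.finrank ℝ (Coker t.D') +
    Module.finrank ℝ (Coker t.D) * Module.finrank ℝ (LinearMap.range t.delta)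

/-- `λ(iX)x ∧_{κ(D)} u` with `x ∈ λ(κ(D'))` and `u ∈ λ(κ(D) / iX(κ(D')))`. -/
noncomputable def wedgeKer (x : Lam (Ker t.D')) (u : Lam (Ker t.D ⧸ LinearMap.range t.kerI)) :
    Lam (Ker t.D) :=
  (isSES_mkQ t.kerI_injective).wedge x u

/-- `λ(jX)u ∧_{κ(D'')} v` with `u ∈ λ(κ(D) / iX(κ(D')))` and `v ∈ λ(κ(D'') / jX(κ(D)))`. -/
noncomputable def wedgeKer'' (u : Lam (Ker t.D ⧸ LinearMap.range t.kerI))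
    (v : Lam (Ker t.D'' ⧸ LinearMap.range t.kerJ)) : Lam (Ker t.D'') :=
  (isSES_bar t.exact_ker).wedge u v

/-- `λ(δ)v ∧_{𝔠(D')} w` with `v ∈ λ(κ(D'') / jX(κ(D)))` and `w ∈ λ(𝔠(D') / δ(κ(D'')))`. -/
noncomputable def wedgeCok' (v : Lam (Ker t.D'' ⧸ LinearMap.range t.kerJ))
    (w : Lam (Coker t.D' ⧸ LinearMap.range t.delta)) : Lam (Coker t.D') :=
  (isSES_bar t.exact_kerJ_delta).wedge v w

/-- `λ(iY)w ∧_{𝔠(D)} y` with `w ∈ λ(𝔠(D') / δ(κ(D'')))` and `y ∈ λ(𝔠(D) / iY(𝔠(D')))`. -/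
noncomputable def wedgeCok (w : Lam (Coker t.D' ⧸ LinearMap.range t.delta))
    (y : Lam (Coker t.D ⧸ LinearMap.range t.cokI)) : Lam (Coker t.D) :=
  (isSES_bar t.exact_delta_cokI).wedge w y

/-- The formula
`Ψ(x ⊗ (λ(δ)v ∧ w)^* ⊗ (λ(jX)u ∧ v) ⊗ (λ(jY)y)^*) = (-1)^{ε_t} (λ(iX)x ∧ u) ⊗ (λ(iY)w ∧ y)^*`
for all nonzero `x, u, v, w, y`, characterizing the isomorphism `Ψ_t`. -/
def IsPsi (Ψ : DetLine t.D' ⊗[ℝ] DetLine t.D'' →ₗ[ℝ] DetLine t.D) : Prop :=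
  ∀ (x : Lam (Ker t.D')) (u : Lam (Ker t.D ⧸ LinearMap.range t.kerI))
    (v : Lam (Ker t.D'' ⧸ LinearMap.range t.kerJ))
    (w : Lam (Coker t.D' ⧸ LinearMap.range t.delta))
    (y : Lam (Coker t.D ⧸ LinearMap.range t.cokI)),
    x ≠ 0 → u ≠ 0 → v ≠ 0 → w ≠ 0 → y ≠ 0 →
      Ψ ((x ⊗ₜ dualElt (t.wedgeCok' v w)) ⊗ₜ (t.wedgeKer'' u v ⊗ₜ dualElt (lamMap t.cokEquiv y))) =
        ((-1 : ℝ) ^ t.eps) • (t.wedgeKer x u ⊗ₜ dualElt (t.wedgeCok w y))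

/-- There is exactly one linear map `λ(D') ⊗ λ(D'') → λ(D)` satisfying the formula. -/
theorem existsUnique_isPsi : ∃! Ψ : DetLine t.D' ⊗[ℝ] DetLine t.D'' →ₗ[ℝ] DetLine t.D,
    t.IsPsi Ψ := by
  exact existsUnique_of_lines finrank_lam finrank_lam finrank_lam finrank_lam finrank_lam
    finrank_lam finrank_lam finrank_lam finrank_lam
    (isSES_bar t.exact_kerJ_delta).wedge (isSES_bar t.exact_ker).wedge
    (isSES_mkQ t.kerI_injective).wedge (isSES_bar t.exact_delta_cokI).wedge
    (lamMap t.cokEquiv) ((-1 : ℝ) ^ t.eps) (IsSES.wedge_ne_zero _) (IsSES.wedge_ne_zero _)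
    (IsSES.wedge_ne_zero _) (lamMap_injective _)

/-- The isomorphism `Ψ_t : λ(D') ⊗ λ(D'') → λ(D)` of an exact triple of Fredholm operators. -/
noncomputable def Psi : DetLine t.D' ⊗[ℝ] DetLine t.D'' →ₗ[ℝ] DetLine t.D :=
  t.existsUnique_isPsi.choose

theorem isPsi_Psi : t.IsPsi t.Psi := t.existsUnique_isPsi.choose_spec.1

end FredTriple
end Triple

section Composition

/-! ### Compositions of Fredholm operators -/

open scoped LinearMap.FiniteRangeSetoid

variable {X₁ X₂ X₃ : Type*} [NormedAddCommGroup X₁] [NormedSpace ℝ X₁]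
  [NormedAddCommGroup X₂] [NormedSpace ℝ X₂] [NormedAddCommGroup X₃] [NormedSpace ℝ X₃]

theorem hasFiniteRange_congr {V W : Type*} [AddCommGroup V] [Module ℝ V] [AddCommGroup W]
    [Module ℝ W] {f g : V →ₗ[ℝ] W} (h : g.HasFiniteRange) (e : ∀ x, f x = g x) :
    f.HasFiniteRange := by
  rwa [LinearMap.ext e]

theorem isFredholm_comp {D₁ : X₁ →L[ℝ] X₂} {D₂ : X₂ →L[ℝ] X₃} (h₁ : D₁.IsFredholm)
    (h₂ : D₂.IsFredholm) : (D₂ ∘L D₁).IsFredholm := by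
  obtain ⟨v₁, hv₁⟩ := h₁.exists_isQuasiInverse
  obtain ⟨v₂, hv₂⟩ := h₂.exists_isQuasiInverse
  exact ContinuousLinearMap.IsFredholm.of_isQuasiInverse (v := v₁ ∘L v₂) (hv₁.comp hv₂)

theorem isFredholm_prodMap_id {D : X₁ →L[ℝ] X₃} (h : D.IsFredholm) :
    (D.prodMap (ContinuousLinearMap.id ℝ X₂)).IsFredholm := by
  obtain ⟨v, hv⟩ := h.exists_isQuasiInverse
  refine ContinuousLinearMap.IsFredholm.of_isQuasiInverse
    (v := v.prodMap (ContinuousLinearMap.id ℝ X₂)) ⟨?_, ?_⟩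
  · have h1 := hv.1
    unfold LinearMap.IsLeftQuasiInverse at h1 ⊢
    rw [LinearMap.FiniteRangeSetoid.equiv_iff_hasFiniteRange] at h1 ⊢
    refine hasFiniteRange_congr ((h1.comp_left (LinearMap.inl ℝ X₁ X₂)).comp_right
      (LinearMap.fst ℝ X₁ X₂)) fun x => ?_
    ext <;> simp
  · have h1 := hv.2
    unfold LinearMap.IsRightQuasiInverse at h1 ⊢
    rw [LinearMap.FiniteRangeSetoid.equiv_iff_hasFiniteRange] at h1 ⊢
    refine hasFiniteRange_congr ((h1.comp_left (LinearMap.inl ℝ X₃ X₂)).comp_right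
      (LinearMap.fst ℝ X₃ X₂)) fun x => ?_
    ext <;> simp

/-- The exact triple
```
0 → X₁ → X₁ ⊕ X₂ → X₂ → 0      x₁ ↦ (x₁, D₁ x₁),   (x₁, x₂) ↦ D₁ x₁ - x₂
    |D₁  |D₂D₁⊕id  |D₂
0 → X₂ → X₃ ⊕ X₂ → X₃ → 0      x₂ ↦ (D₂ x₂, x₂),   (x₃, x₂) ↦ x₃ - D₂ x₂
```
associated with a composition `D₁₂ = D₂ ∘ D₁`. -/
noncomputable def compTriple (D₁ : X₁ →L[ℝ] X₂) (D₂ : X₂ →L[ℝ] X₃) (D₁₂ : X₁ →L[ℝ] X₃)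
    (h : D₂ ∘L D₁ = D₁₂) (h₁ : D₁.IsFredholm) (h₂ : D₂.IsFredholm) :
    FredTriple X₁ (X₁ × X₂) X₂ X₂ (X₃ × X₂) X₃ where
  D' := D₁
  D := D₁₂.prodMap (ContinuousLinearMap.id ℝ X₂)
  D'' := D₂
  fredholm' := h₁
  fredholm := isFredholm_prodMap_id (h ▸ isFredholm_comp h₁ h₂)
  fredholm'' := h₂
  iX := (ContinuousLinearMap.id ℝ X₁).prod D₁
  jX := D₁ ∘L ContinuousLinearMap.fst ℝ X₁ X₂ - ContinuousLinearMap.snd ℝ X₁ X₂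
  iY := D₂.prod (ContinuousLinearMap.id ℝ X₂)
  jY := ContinuousLinearMap.fst ℝ X₃ X₂ - D₂ ∘L ContinuousLinearMap.snd ℝ X₃ X₂
  sesX :=
    { inj := fun x y hxy => congrArg Prod.fst hxy
      exact := by
        rintro ⟨a, b⟩
        simp only [ContinuousLinearMap.coe_coe, sub_apply, Set.mem_range]
        constructor
        · intro hab
          exact ⟨a, Prod.ext rfl (sub_eq_zero.1 hab)⟩
        · rintro ⟨x, hx⟩
          have h1 : x = a := congrArg Prod.fst hx
          have h2 : D₁ x = b := congrArg Prod.snd hx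
          subst h1 h2
          simp
      surj := fun x => ⟨(0, -x), by simp⟩ }
  sesY :=
    { inj := fun x y hxy => congrArg Prod.snd hxy
      exact := by
        rintro ⟨a, b⟩
        simp only [ContinuousLinearMap.coe_coe, sub_apply, Set.mem_range]
        constructor
        · intro hab
          exact ⟨b, Prod.ext (sub_eq_zero.1 hab).symm rfl⟩
        · rintro ⟨x, hx⟩
          have h1 : x = b := congrArg Prod.snd hx
          have h2 : D₂ x = a := congrArg Prod.fst hx
          subst h1 h2
          simp
      surj := fun x => ⟨(x, 0), by simp⟩ }
  comm_i := by
    subst h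
    ext x <;> simp
  comm_j := by
    subst h
    ext x <;> simp

variable (Z : Type*) [NormedAddCommGroup Z] [NormedSpace ℝ Z]

/-- The isomorphism `κ(D ⊕ id_Z) ≃ κ(D)`, `(x, 0) ↦ x`. -/
noncomputable def kerSumId (D : X₁ →L[ℝ] X₃) :
    Ker (D.prodMap (ContinuousLinearMap.id ℝ Z)) ≃ₗ[ℝ] Ker D where
  toFun x := ⟨x.1.1, congrArg Prod.fst x.2⟩
  map_add' _ _ := rfl
  map_smul' _ _ := rfl
  invFun x := ⟨(x.1, 0), Prod.ext x.2 rfl⟩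
  left_inv x := Subtype.ext (Prod.ext rfl (congrArg Prod.snd x.2).symm)
  right_inv _ := rfl

/-- The isomorphism `𝔠(D) ≃ 𝔠(D ⊕ id_Z)`, `[y] ↦ [(y, 0)]`. -/
noncomputable def cokSumId (D : X₁ →L[ℝ] X₃) :
    Coker D ≃ₗ[ℝ] Coker (D.prodMap (ContinuousLinearMap.id ℝ Z)) :=
  LinearEquiv.ofBijective
    (Submodule.mapQ (LinearMap.range D.toLinearMap)
      (LinearMap.range (D.prodMap (ContinuousLinearMap.id ℝ Z)).toLinearMap)
      (LinearMap.inl ℝ X₃ Z) (by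
        rintro _ ⟨x, rfl⟩
        exact ⟨(x, 0), by simp⟩))
    (by
      constructor
      · rw [injective_iff_map_eq_zero]
        intro y
        induction y using Submodule.Quotient.induction_on with
        | _ y =>
        intro hy
        rw [Submodule.mapQ_apply, Submodule.Quotient.mk_eq_zero] at hy
        obtain ⟨x, hx⟩ := hy
        rw [Submodule.Quotient.mk_eq_zero]
        exact ⟨x.1, congrArg Prod.fst hx⟩
      · intro y
        induction y using Submodule.Quotient.induction_on with
        | _ y =>
        refine ⟨Submodule.Quotient.mk y.1, ?_⟩
        rw [Submodule.mapQ_apply, Submodule.Quotient.eq]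
        exact ⟨(0, -y.2), by ext <;> simp⟩)

/-- The canonical identification `λ(D ⊕ id_Z) = λ(D)`,
`(x₁,0) ∧ … ∧ (x_k,0) ⊗ ((y₁,0) ∧ … ∧ (y_l,0))^* ↔ x₁ ∧ … ∧ x_k ⊗ (y₁ ∧ … ∧ y_l)^*`. -/
noncomputable def sumIdMap (D : X₁ →L[ℝ] X₃) :
    DetLine (D.prodMap (ContinuousLinearMap.id ℝ Z)) →ₗ[ℝ] DetLine D :=
  TensorProduct.map (lamMap (kerSumId Z D)) (lamMap (cokSumId Z D)).dualMap

/-- The isomorphism `C̃_{D₁,D₂} : λ(D₁) ⊗ λ(D₂) → λ(D₁₂)` for `D₁₂ = D₂ ∘ D₁`: the isomorphism `Ψ`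
of the associated exact triple, followed by the identification `λ(D₁₂ ⊕ id) = λ(D₁₂)`. -/
noncomputable def compMap (D₁ : X₁ →L[ℝ] X₂) (D₂ : X₂ →L[ℝ] X₃) (D₁₂ : X₁ →L[ℝ] X₃)
    (h : D₂ ∘L D₁ = D₁₂) (h₁ : D₁.IsFredholm) (h₂ : D₂.IsFredholm) :
    DetLine D₁ ⊗[ℝ] DetLine D₂ →ₗ[ℝ] DetLine D₁₂ :=
  sumIdMap X₂ D₁₂ ∘ₗ (compTriple D₁ D₂ D₁₂ h h₁ h₂).Psi

end Composition

section Stabilization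

/-! ### Stabilizations of Fredholm operators -/

open scoped LinearMap.FiniteRangeSetoid

/-- The standard volume tensor `Ω_N = e₁ ∧ … ∧ e_N` on `ℝ^N`. -/
noncomputable def vol (N : ℕ) : Lam (Fin N → ℝ) :=
  ⟨ExteriorAlgebra.ιMulti ℝ N (fun k => Pi.single k (1 : ℝ)), by
    rw [Module.finrank_fin_fun]
    exact ExteriorAlgebra.ιMulti_range ℝ N ⟨_, rfl⟩⟩

/-- The canonical generator `1 ∈ λ(0) = ℝ` for a zero vector space. -/
noncomputable def lamOne (V : Type*) [AddCommGroup V] [Module ℝ V]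
    (hV : Module.finrank ℝ V = 0) : Lam V :=
  ⟨1, by rw [hV]; exact SetLike.one_mem_graded (A := fun n : ℕ => ⋀[ℝ]^n V)⟩

variable {X Y : Type*} [NormedAddCommGroup X] [NormedSpace ℝ X]
  [NormedAddCommGroup Y] [NormedSpace ℝ Y] {N : ℕ}

/-- The stabilization `D_Θ : X ⊕ ℝ^N → Y`, `D_Θ(x, u) = D x + Θ u`. -/
noncomputable def stab (D : X →L[ℝ] Y) (Θ : (Fin N → ℝ) →L[ℝ] Y) : X × (Fin N → ℝ) →L[ℝ] Y :=
  D.coprod Θ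

theorem isFredholm_stab {D : X →L[ℝ] Y} (h : D.IsFredholm) (Θ : (Fin N → ℝ) →L[ℝ] Y) :
    (stab D Θ).IsFredholm := by
  obtain ⟨v, hv⟩ := h.exists_isQuasiInverse
  refine ContinuousLinearMap.IsFredholm.of_isQuasiInverse
    (v := ContinuousLinearMap.inl ℝ X (Fin N → ℝ) ∘L v) ⟨?_, ?_⟩
  · have h1 := hv.1
    unfold LinearMap.IsLeftQuasiInverse at h1 ⊢
    rw [LinearMap.FiniteRangeSetoid.equiv_iff_hasFiniteRange] at h1 ⊢
    have h2 : (((LinearMap.inl ℝ X (Fin N → ℝ)) ∘ₗ v.toLinearMap ∘ₗ Θ.toLinearMap -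
      LinearMap.inr ℝ X (Fin N → ℝ)) ∘ₗ LinearMap.snd ℝ X (Fin N → ℝ)).HasFiniteRange :=
      LinearMap.HasFiniteRange.comp_right LinearMap.HasFiniteRange.of_finite_dom _
    refine hasFiniteRange_congr (((h1.comp_left (LinearMap.inl ℝ X (Fin N → ℝ))).comp_right
      (LinearMap.fst ℝ X (Fin N → ℝ))).add h2) fun x => ?_
    (ext <;> simp [stab]); abel
  · have h1 := hv.2
    unfold LinearMap.IsRightQuasiInverse at h1 ⊢
    rw [LinearMap.FiniteRangeSetoid.equiv_iff_hasFiniteRange] at h1 ⊢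
    refine hasFiniteRange_congr h1 fun x => ?_
    simp [stab]

variable (X N) in
/-- The inclusion `ι_{X;N} : X → X ⊕ ℝ^N`. -/
noncomputable def incl : X →L[ℝ] X × (Fin N → ℝ) := ContinuousLinearMap.inl ℝ X (Fin N → ℝ)

theorem isFredholm_incl : (incl X N).IsFredholm := by
  refine ContinuousLinearMap.IsFredholm.of_isQuasiInverse
    (v := ContinuousLinearMap.fst ℝ X (Fin N → ℝ)) ⟨?_, ?_⟩
  · unfold LinearMap.IsLeftQuasiInverse
    rw [LinearMap.FiniteRangeSetoid.equiv_iff_hasFiniteRange]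
    refine hasFiniteRange_congr (LinearMap.HasFiniteRange.zero (K := ℝ)) fun x => ?_
    simp [incl]
  · unfold LinearMap.IsRightQuasiInverse
    rw [LinearMap.FiniteRangeSetoid.equiv_iff_hasFiniteRange]
    have h2 : ((-LinearMap.inr ℝ X (Fin N → ℝ)) ∘ₗ
        LinearMap.snd ℝ X (Fin N → ℝ)).HasFiniteRange :=
      LinearMap.HasFiniteRange.comp_right LinearMap.HasFiniteRange.of_finite_dom _
    refine hasFiniteRange_congr h2 fun x => ?_
    ext <;> simp [incl]

theorem stab_comp_incl (D : X →L[ℝ] Y) (Θ : (Fin N → ℝ) →L[ℝ] Y) :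
    stab D Θ ∘L incl X N = D := by
  ext x
  simp [stab, incl]

theorem finrank_ker_incl : Module.finrank ℝ (Ker (incl X N)) = 0 := by
  have : Subsingleton (Ker (incl X N)) :=
    ⟨fun a b => Subtype.ext ((congrArg Prod.fst a.2).trans (congrArg Prod.fst b.2).symm)⟩
  exact Module.finrank_zero_of_subsingleton

variable (X N) in
/-- The isomorphism `π₂ : 𝔠(ι_{X;N}) ≃ ℝ^N` induced by the projection `X ⊕ ℝ^N → ℝ^N`. -/
noncomputable def cokIncl : Coker (incl X N) ≃ₗ[ℝ] (Fin N → ℝ) :=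
  LinearEquiv.ofBijective
    ((LinearMap.range (incl X N).toLinearMap).liftQ (LinearMap.snd ℝ X (Fin N → ℝ)) (by
      rintro _ ⟨x, rfl⟩
      simp [incl]))
    (by
      constructor
      · rw [injective_iff_map_eq_zero]
        intro y
        induction y using Submodule.Quotient.induction_on with
        | _ y =>
        intro hy
        rw [Submodule.Quotient.mk_eq_zero]
        exact ⟨y.1, Prod.ext rfl (Eq.symm hy)⟩
      · intro y
        exact ⟨Submodule.Quotient.mk (0, y), rfl⟩)

/-- The isomorphism
`I_{Θ;D} : λ(D_Θ) → λ(D)`, `σ ↦ C̃_{ι_{X;N},D_Θ}(1 ⊗ (Ω_N^* ∘ λ(π₂)) ⊗ σ)`. -/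
noncomputable def stabMap (D : X →L[ℝ] Y) (hD : D.IsFredholm) (Θ : (Fin N → ℝ) →L[ℝ] Y) :
    DetLine (stab D Θ) →ₗ[ℝ] DetLine D :=
  compMap (incl X N) (stab D Θ) D (stab_comp_incl D Θ) isFredholm_incl (isFredholm_stab hD Θ) ∘ₗ
    TensorProduct.mk ℝ (DetLine (incl X N)) (DetLine (stab D Θ))
      (lamOne (Ker (incl X N)) finrank_ker_incl ⊗ₜ[ℝ] (dualElt (vol N) ∘ₗ lamMap (cokIncl X N)))

variable {X' X'' Y' Y'' : Type*}
  [NormedAddCommGroup X'] [NormedSpace ℝ X'] [NormedAddCommGroup X''] [NormedSpace ℝ X'']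
  [NormedAddCommGroup Y'] [NormedSpace ℝ Y'] [NormedAddCommGroup Y''] [NormedSpace ℝ Y'']

/-- An exact triple of homomorphisms
```
0 → ℝ^N' --i-→ ℝ^N --j-→ ℝ^N'' → 0
      |Θ'       |Θ        |Θ''
0 →  Y' --iY→   Y  --jY→  Y''  → 0
```
over the bottom row of an exact triple `t` of Fredholm operators. -/
structure StabTriple (t : FredTriple X' X X'' Y' Y Y'') (N' N N'' : ℕ) where
  Θ' : (Fin N' → ℝ) →L[ℝ] Y'
  Θ : (Fin N → ℝ) →L[ℝ] Y
  Θ'' : (Fin N'' → ℝ) →L[ℝ] Y''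
  i : (Fin N' → ℝ) →L[ℝ] (Fin N → ℝ)
  j : (Fin N → ℝ) →L[ℝ] (Fin N'' → ℝ)
  ses : IsSES i.toLinearMap j.toLinearMap
  comm_i : t.iY ∘L Θ' = Θ ∘L i
  comm_j : t.jY ∘L Θ = Θ'' ∘L j

variable {t : FredTriple X' X X'' Y' Y Y''} {N' N'' : ℕ}

/-- The number `A_s` defined by `λ(i)Ω_{N'} ∧_{ℝ^N} Ω_{N''} = A_s Ω_N`. -/
noncomputable def StabTriple.A (s : StabTriple t N' N N'') : ℝ :=
  dualElt (vol N) (s.ses.wedge (vol N') (vol N''))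

theorem vol_ne_zero (N : ℕ) : vol N ≠ 0 := by
  intro h0
  have h1 : exteriorPower.ιMulti ℝ N (Pi.basisFun ℝ (Fin N) : _ → _) = 0 := by
    apply Subtype.ext
    have h2 : (Pi.basisFun ℝ (Fin N) : Fin N → Fin N → ℝ) = fun k => Pi.single k (1 : ℝ) := by
      funext k; simp
    rw [exteriorPower.ιMulti_apply_coe, h2]
    exact congrArg Subtype.val h0
  have h4 := exteriorPower.alternatingMapLinearEquiv_apply_ιMulti
    (Pi.basisFun ℝ (Fin N)).det (Pi.basisFun ℝ (Fin N))
  rw [h1, map_zero, (Pi.basisFun ℝ (Fin N)).det_self] at h4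
  exact zero_ne_one h4

theorem StabTriple.A_spec (s : StabTriple t N' N N'') :
    s.ses.wedge (vol N') (vol N'') = s.A • vol N := by
  obtain ⟨c, hc⟩ := eq_smul_of_line finrank_lam (vol_ne_zero N)
    (s.ses.wedge (vol N') (vol N''))
  rw [StabTriple.A, hc, map_smul, dualElt_self (vol_ne_zero N), smul_eq_mul, mul_one]

theorem StabTriple.A_ne_zero (s : StabTriple t N' N N'') : s.A ≠ 0 := by
  intro h
  have := s.A_spec
  rw [h, zero_smul] at this
  exact s.ses.wedge_ne_zero (vol_ne_zero N') (vol_ne_zero N'') this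

theorem isSES_prodMap {i : X' →L[ℝ] X} {j : X →L[ℝ] X''} {k : Y' →L[ℝ] Y} {l : Y →L[ℝ] Y''}
    (h : IsSES i.toLinearMap j.toLinearMap) (h' : IsSES k.toLinearMap l.toLinearMap) :
    IsSES (i.prodMap k).toLinearMap (j.prodMap l).toLinearMap where
  inj := fun x y hxy => Prod.ext (h.inj (congrArg Prod.fst hxy)) (h'.inj (congrArg Prod.snd hxy))
  exact := by
    rintro ⟨a, b⟩
    constructor
    · intro hab
      obtain ⟨x, hx⟩ := (h.exact a).1 (congrArg Prod.fst hab)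
      obtain ⟨y, hy⟩ := (h'.exact b).1 (congrArg Prod.snd hab)
      exact ⟨(x, y), Prod.ext hx hy⟩
    · rintro ⟨⟨x, y⟩, hxy⟩
      rw [← hxy]
      exact Prod.ext (h.exact.apply_apply_eq_zero x) (h'.exact.apply_apply_eq_zero y)
  surj := by
    rintro ⟨a, b⟩
    obtain ⟨x, hx⟩ := h.surj a
    obtain ⟨y, hy⟩ := h'.surj b
    exact ⟨(x, y), Prod.ext hx hy⟩

/-- The stabilized exact triple `t_s` of Fredholm operators
```
0 → X' ⊕ ℝ^N' --iX⊕i→ X ⊕ ℝ^N --jX⊕j→ X'' ⊕ ℝ^N'' → 0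
      |D'_Θ'           |D_Θ             |D''_Θ''
0 →   Y'   -----iY--→  Y   -----jY--→   Y''  → 0
``` -/
noncomputable def stabTriple (t : FredTriple X' X X'' Y' Y Y'') (s : StabTriple t N' N N'') :
    FredTriple (X' × (Fin N' → ℝ)) (X × (Fin N → ℝ)) (X'' × (Fin N'' → ℝ)) Y' Y Y'' where
  D' := stab t.D' s.Θ'
  D := stab t.D s.Θ
  D'' := stab t.D'' s.Θ''
  fredholm' := isFredholm_stab t.fredholm' s.Θ'
  fredholm := isFredholm_stab t.fredholm s.Θ
  fredholm'' := isFredholm_stab t.fredholm'' s.Θ''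
  iX := t.iX.prodMap s.i
  jX := t.jX.prodMap s.j
  iY := t.iY
  jY := t.jY
  sesX := isSES_prodMap t.sesX s.ses
  sesY := t.sesY
  comm_i := by
    refine ContinuousLinearMap.ext fun x => ?_
    have h1 := t.comm_i_apply x.1
    have h2 : t.iY (s.Θ' x.2) = s.Θ (s.i x.2) := DFunLike.congr_fun s.comm_i x.2
    simp [stab, h1, h2]
  comm_j := by
    refine ContinuousLinearMap.ext fun x => ?_
    have h1 := t.comm_j_apply x.1
    have h2 : t.jY (s.Θ x.2) = s.Θ'' (s.j x.2) := DFunLike.congr_fun s.comm_j x.2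
    simp [stab, h1, h2]

end Stabilization

end FredDet

/-! The determinant line of a Fredholm operator can be computed in finite dimensions. If `F ⊆ Y` is
finite-dimensional with `im D + F = Y`, and `f : E → F` is the restriction of `D` to `E = D⁻¹(F)`,
then `0 → κ(D) → E → F → 𝔠(D) → 0` is exact, so `λ(E) ⊗ λ(F)^*` is identified with `λ(D)`. The
identification `FourTerm.red` carries the sign `(-1)^{rk f (dim F + 1)}`. With this choice the ranks
of `f` and of the connecting map disappear, and each structure map gets a formula involving only the
dimensions of the approximating spaces:

`Ψ` (`ApproxTriple.psi_red`) is `(α' ⊗ β'^*) ⊗ (α'' ⊗ β''^*) ↦ ± (α' ∧ α'') ⊗ (β' ∧ β'')^*` with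
exponent `(dim E'' + dim F'') dim F'`; `C̃` (`compMap_red`) is the contraction `(α ⊗ β^*) ⊗ (β ⊗
γ^*) ↦ α ⊗ γ^*`, without sign; `I` (`stabMap_red`) is `(α ∧ Ω_N) ⊗ β^* ↦ (-1)^{N dim E} α ⊗ β^*`.

One subspace `S ⊆ Y` containing `im Θ` serves all three columns: its preimage in `Y'` and its image
in `Y''` are made transverse to `D'` and `D''`. Stabilizing then keeps `F` and replaces `E` by `E ⊕
ℝ^N`, and likewise in the outer columns. On a generator, both sides of the theorem are multiples of
the element given by `(α' ∧ α'') ⊗ (β' ∧ β'')^*`. The factor `A_s` comes from `Ω_{N'} ∧ Ω_{N''}`,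
and moving `Ω_{N'}` past `α''` contributes `N' dim E''`. The exponents of the two sides differ by
`N'' (dim E' + dim F')`, which has the parity of `N'' ind D'`. -/

open scoped TensorProduct

namespace FredDet

/-! ### Top exterior powers in terms of lists of vectors -/

section Lists

variable {V V' V'' W : Type*} [AddCommGroup V] [Module ℝ V] [AddCommGroup V'] [Module ℝ V']
  [AddCommGroup V''] [Module ℝ V''] [AddCommGroup W] [Module ℝ W]

/-- The product `v₁ ∧ … ∧ v_k` of a list of vectors in the exterior algebra. -/
noncomputable def wedgeProd (l : List V) : ExteriorAlgebra ℝ V :=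
  (l.map (ExteriorAlgebra.ι ℝ)).prod

@[simp] theorem wedgeProd_nil : wedgeProd ([] : List V) = 1 := rfl

@[simp] theorem wedgeProd_cons (a : V) (l : List V) :
    wedgeProd (a :: l) = ExteriorAlgebra.ι ℝ a * wedgeProd l := rfl

@[simp] theorem wedgeProd_append (a b : List V) :
    wedgeProd (a ++ b) = wedgeProd a * wedgeProd b := by
  simp [wedgeProd]

theorem wedgeProd_ofFn {n : ℕ} (v : Fin n → V) :
    wedgeProd (List.ofFn v) = ExteriorAlgebra.ιMulti ℝ n v := by
  rw [ExteriorAlgebra.ιMulti_apply, wedgeProd, List.map_ofFn]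
  rfl

theorem wedgeProd_eq_ιMulti (l : List V) :
    wedgeProd l = ExteriorAlgebra.ιMulti ℝ l.length l.get := by
  rw [← wedgeProd_ofFn, List.ofFn_get]

theorem wedgeProd_mem (l : List V) : wedgeProd l ∈ ⋀[ℝ]^l.length V := by
  rw [wedgeProd_eq_ιMulti]
  exact ExteriorAlgebra.ιMulti_range ℝ _ ⟨_, rfl⟩

theorem map_wedgeProd (f : V →ₗ[ℝ] W) (l : List V) :
    ExteriorAlgebra.map f (wedgeProd l) = wedgeProd (l.map f) := by
  induction l with
  | nil => simp
  | cons a l ih => simp [ih]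

theorem ι_mul_wedgeProd (b : V) (l : List V) :
    ExteriorAlgebra.ι ℝ b * wedgeProd l =
      (-1 : ℝ) ^ l.length • (wedgeProd l * ExteriorAlgebra.ι ℝ b) := by
  rw [wedgeProd_eq_ιMulti]
  exact IsSES.ι_mul_ιMulti b _ _

theorem wedgeProd_mul_comm (a b : List V) :
    wedgeProd a * wedgeProd b =
      (-1 : ℝ) ^ (a.length * b.length) • (wedgeProd b * wedgeProd a) := by
  induction a with
  | nil => simp
  | cons x a ih =>
    rw [wedgeProd_cons, mul_assoc, ih, mul_smul_comm, ← mul_assoc, ι_mul_wedgeProd,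
      smul_mul_assoc, smul_smul, mul_assoc, List.length_cons, ← pow_add]
    congr 2
    ring

theorem wedgeProd_neg (l : List V) :
    wedgeProd (l.map Neg.neg) = (-1 : ℝ) ^ l.length • wedgeProd l := by
  induction l with
  | nil => simp
  | cons a l ih => simp [ih, pow_succ]

open Classical in
/-- The element `v₁ ∧ … ∧ v_k` of `λ(V)` for a list of `k = dim V` vectors, and zero for a list of
another length. -/
noncomputable def lamList (l : List V) : Lam V :=
  if h : l.length = Module.finrank ℝ V then ⟨wedgeProd l, h ▸ wedgeProd_mem l⟩ else 0

theorem lamList_coe {l : List V} (h : l.length = Module.finrank ℝ V) :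
    (lamList l).1 = wedgeProd l := by
  rw [lamList, dif_pos h]

theorem length_of_lamList_ne_zero {l : List V} (h : lamList l ≠ 0) :
    l.length = Module.finrank ℝ V := by
  by_contra h'
  exact h (dif_neg h')

theorem lamList_eq_smul {l l' : List V} {c : ℝ} (h : l.length = l'.length)
    (h' : wedgeProd l = c • wedgeProd l') : lamList l = c • lamList l' := by
  by_cases hl : l.length = Module.finrank ℝ V
  · apply Subtype.ext
    rw [lamList_coe hl, h', ← lamList_coe (h ▸ hl)]
    rfl
  · rw [lamList, lamList, dif_neg hl, dif_neg (h ▸ hl), smul_zero]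

/-- All reordering signs below come from this exchange of two adjacent blocks. -/
theorem lamList_swap (a b c d : List V) :
    lamList (a ++ (b ++ (c ++ d))) =
      (-1 : ℝ) ^ (b.length * c.length) • lamList (a ++ (c ++ (b ++ d))) := by
  apply lamList_eq_smul
  · simp only [List.length_append]
    omega
  · simp only [wedgeProd_append]
    rw [← mul_assoc (wedgeProd b), wedgeProd_mul_comm b c]
    simp only [smul_mul_assoc, mul_smul_comm, mul_assoc]

theorem lamList_append_comm (a b : List V) :
    lamList (a ++ b) = (-1 : ℝ) ^ (a.length * b.length) • lamList (b ++ a) := by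
  simpa using lamList_swap [] a b []

theorem lamList_append_neg (a b : List V) :
    lamList (a ++ b.map Neg.neg) = (-1 : ℝ) ^ b.length • lamList (a ++ b) := by
  apply lamList_eq_smul
  · simp
  · simp only [wedgeProd_append, wedgeProd_neg, mul_smul_comm]

theorem exists_lamList_ne_zero [FiniteDimensional ℝ V] : ∃ l : List V, lamList l ≠ 0 := by
  let b := Module.finBasis ℝ V
  refine ⟨List.ofFn b, fun h0 => ?_⟩
  have h3 : exteriorPower.ιMulti ℝ _ (b : _ → V) = 0 := by
    apply Subtype.ext
    rw [exteriorPower.ιMulti_apply_coe, ← wedgeProd_ofFn, ← lamList_coe (by simp), h0]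
  have h4 := exteriorPower.alternatingMapLinearEquiv_apply_ιMulti b.det b
  rw [h3, map_zero, b.det_self] at h4
  exact zero_ne_one h4

/-- Bases of quotients are always represented by lifts, the form in which `IsSES.wedge_lamList` uses
them. -/
theorem exists_lamList_map_ne_zero [FiniteDimensional ℝ W] {j : V →ₗ[ℝ] W}
    (h : Function.Surjective j) : ∃ l : List V, lamList (l.map j) ≠ 0 := by
  obtain ⟨l, hl⟩ := exists_lamList_ne_zero (V := W)
  obtain ⟨l', rfl⟩ := List.map_surjective_iff.2 h l
  exact ⟨l', hl⟩

theorem exteriorPower_map_coe (n : ℕ) (f : V →ₗ[ℝ] W) (a : ⋀[ℝ]^n V) :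
    (exteriorPower.map n f a).1 = ExteriorAlgebra.map f a.1 := by
  have : (⋀[ℝ]^n W).subtype ∘ₗ exteriorPower.map n f =
      (ExteriorAlgebra.map f).toLinearMap ∘ₗ (⋀[ℝ]^n V).subtype := by
    ext v
    simp [ExteriorAlgebra.map_apply_ιMulti]
  exact LinearMap.congr_fun this a

theorem lamMap_coe (e : V ≃ₗ[ℝ] W) (a : Lam V) :
    (lamMap e a).1 = ExteriorAlgebra.map e.toLinearMap a.1 := by
  rw [← exteriorPower_map_coe, lamMap, LinearMap.comp_apply, LinearEquiv.coe_coe,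
    LinearEquiv.coe_ofEq_apply]

theorem lamMap_lamList (e : V ≃ₗ[ℝ] W) (l : List V) :
    lamMap e (lamList l) = lamList (l.map e) := by
  by_cases hl : l.length = Module.finrank ℝ V
  · apply Subtype.ext
    rw [lamList_coe (by simp [hl, e.finrank_eq]), lamMap_coe, lamList_coe hl, map_wedgeProd]
    rfl
  · rw [lamList, dif_neg hl, map_zero, lamList, dif_neg (by simpa [← e.finrank_eq] using hl)]

namespace IsSES

variable {i : V' →ₗ[ℝ] V} {j : V →ₗ[ℝ] V''}

/-- Only `l'` needs a length hypothesis: by additivity of dimension, a list `l` of the wrong length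
makes both sides the default value zero. -/
theorem wedge_lamList (h : IsSES i j) [FiniteDimensional ℝ V] {l' : List V'} {l : List V}
    (hl' : l'.length = Module.finrank ℝ V') :
    h.wedge (lamList l') (lamList (l.map j)) = lamList (l'.map i ++ l) := by
  have hV := h.finrank_eq
  by_cases hl : l.length = Module.finrank ℝ V''
  · apply Subtype.ext
    have key := h.wedge_ιMulti (fun k => l'.get (Fin.cast hl'.symm k))
      (fun k => l.get (Fin.cast hl.symm k))
    have h1 : List.ofFn (fun k => l'.get (Fin.cast hl'.symm k)) = l' := by
      rw [← List.ofFn_congr hl', List.ofFn_get]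
    have h2 : List.ofFn (fun k => l.get (Fin.cast hl.symm k)) = l := by
      rw [← List.ofFn_congr hl, List.ofFn_get]
    have e1 : lamList l' = exteriorPower.ιMulti ℝ _ (fun k => l'.get (Fin.cast hl'.symm k)) := by
      apply Subtype.ext
      rw [lamList_coe hl', exteriorPower.ιMulti_apply_coe, ← wedgeProd_ofFn, h1]
    have e2 : lamList (l.map j) =
        exteriorPower.ιMulti ℝ _ (j ∘ fun k => l.get (Fin.cast hl.symm k)) := by
      apply Subtype.ext
      rw [lamList_coe (by simpa using hl), exteriorPower.ιMulti_apply_coe, ← wedgeProd_ofFn,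
        ← List.map_ofFn, h2]
    rw [e1, e2, key, ← wedgeProd_ofFn, List.ofFn_fin_append, ← List.map_ofFn, h1, h2,
      lamList_coe (by simp [hl, hl', hV])]
  · rw [lamList.eq_1 (l.map j), dif_neg (by simpa using hl), map_zero, lamList,
      dif_neg (by simp; omega)]

theorem lamList_ne_zero_left (h : IsSES i j) [FiniteDimensional ℝ V] {l' : List V'} {l : List V}
    (hl' : l'.length = Module.finrank ℝ V') (h0 : lamList (l'.map i ++ l) ≠ 0) :
    lamList l' ≠ 0 := by
  intro h1
  rw [← h.wedge_lamList hl', h1] at h0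
  simp at h0

theorem lamList_ne_zero_right (h : IsSES i j) [FiniteDimensional ℝ V] {l' : List V'} {l : List V}
    (hl' : l'.length = Module.finrank ℝ V') (h0 : lamList (l'.map i ++ l) ≠ 0) :
    lamList (l.map j) ≠ 0 := by
  intro h1
  rw [← h.wedge_lamList hl', h1] at h0
  simp at h0

theorem lamList_append_ne_zero (h : IsSES i j) [FiniteDimensional ℝ V] {l' : List V'} {l : List V}
    (h' : lamList l' ≠ 0) (h'' : lamList (l.map j) ≠ 0) : lamList (l'.map i ++ l) ≠ 0 := by
  rw [← h.wedge_lamList (length_of_lamList_ne_zero h')]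
  exact h.wedge_ne_zero h' h''

/-- The exterior product of a basis of a subspace with lifts of vectors of the quotient is
independent of the lifts. -/
theorem lamList_append_congr (h : IsSES i j) [FiniteDimensional ℝ V] {l' : List V'}
    {l m : List V} (hl' : l'.length = Module.finrank ℝ V') (hlm : l.map j = m.map j) :
    lamList (l'.map i ++ l) = lamList (l'.map i ++ m) := by
  rw [← h.wedge_lamList hl', hlm, h.wedge_lamList hl']

end IsSES

theorem vol_eq_lamList (N : ℕ) :
    vol N = lamList (List.ofFn fun k : Fin N => (Pi.single k (1 : ℝ) : Fin N → ℝ)) := by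
  apply Subtype.ext
  rw [lamList_coe (by simp), wedgeProd_ofFn]
  rfl

theorem lamOne_eq_lamList (hV : Module.finrank ℝ V = 0) : lamOne V hV = lamList [] := by
  apply Subtype.ext
  rw [lamList_coe (by simp [hV])]
  rfl

theorem dualElt_lamList_comp_lamMap [FiniteDimensional ℝ V] (e : V ≃ₗ[ℝ] W) {l : List V}
    (hl : lamList l ≠ 0) :
    dualElt (lamList (l.map e)) ∘ₗ lamMap e = dualElt (lamList l) := by
  apply dualElt_unique finrank_lam
  rw [LinearMap.comp_apply, lamMap_lamList, dualElt_self]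
  rw [← lamMap_lamList]
  exact fun h => hl (lamMap_injective e (by rw [h, map_zero]))

end Lists

/-! ### Parity of exponents -/

section Signs

theorem neg_one_pow_ne_zero (n : ℕ) : ((-1 : ℝ) ^ n) ≠ 0 := pow_ne_zero _ (by norm_num)

theorem neg_one_pow_inv (n : ℕ) : ((-1 : ℝ) ^ n)⁻¹ = (-1) ^ n := by
  rw [← inv_pow, inv_neg_one]

/-- Reduces each comparison of signs to a polynomial identity over `ZMod 2`, which a finite check
decides. -/
theorem neg_one_pow_congr {m n : ℕ} (h : (m : ZMod 2) = n) : (-1 : ℝ) ^ m = (-1) ^ n := by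
  rw [neg_one_pow_eq_pow_mod_two, (ZMod.natCast_eq_natCast_iff' m n 2).1 h,
    ← neg_one_pow_eq_pow_mod_two]

theorem neg_one_zpow_congr {m : ℤ} {n : ℕ} (h : (m : ZMod 2) = n) :
    (-1 : ℝ) ^ m = (-1) ^ n := by
  have h2 : (2 : ℤ) ∣ m - n := by
    exact_mod_cast (ZMod.intCast_eq_intCast_iff_dvd_sub n m 2).1 (by simp [h])
  obtain ⟨k, hk⟩ := h2
  have : m = n + 2 * k := by omega
  rw [this, zpow_add₀ (by norm_num), zpow_mul]
  simp

end Signs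

/-! ### Determinant lines of four-term exact sequences -/

section FourTerm

variable {K E F C : Type*} [AddCommGroup K] [Module ℝ K] [AddCommGroup E] [Module ℝ E]
  [AddCommGroup F] [Module ℝ F] [AddCommGroup C] [Module ℝ C]

/-- An exact sequence `0 → K → E → F → C → 0`. -/
structure FourTerm (l : K →ₗ[ℝ] E) (f : E →ₗ[ℝ] F) (q : F →ₗ[ℝ] C) : Prop where
  inj : Function.Injective l
  exact_left : Function.Exact l f
  exact_right : Function.Exact f q
  surj : Function.Surjective q

namespace FourTerm

variable {l : K →ₗ[ℝ] E} {f : E →ₗ[ℝ] F} {q : F →ₗ[ℝ] C}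

theorem ses_left (S : FourTerm l f q) : IsSES l (LinearMap.range l).mkQ := isSES_mkQ S.inj

/-- The quotient `E / K` is isomorphic to `im f = ker q`. -/
theorem ses_right (S : FourTerm l f q) : IsSES (bar l f S.exact_left) q where
  inj := bar_injective _
  exact := by
    have h := S.exact_right
    rw [LinearMap.exact_iff] at h ⊢
    rw [h, bar, Submodule.range_liftQ]
  surj := S.surj

theorem finite_left (S : FourTerm l f q) [FiniteDimensional ℝ E] : FiniteDimensional ℝ K :=
  Module.Finite.of_injective l S.inj

theorem finite_right (S : FourTerm l f q) [FiniteDimensional ℝ F] : FiniteDimensional ℝ C :=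
  Module.Finite.of_surjective q S.surj

theorem lamList_ne_zero_left (S : FourTerm l f q) [FiniteDimensional ℝ E] {x : List K} {p : List E}
    (hx : lamList x ≠ 0) (hp : lamList (p.map (LinearMap.range l).mkQ) ≠ 0) :
    lamList (x.map l ++ p) ≠ 0 :=
  S.ses_left.lamList_append_ne_zero hx hp

theorem lamList_ne_zero_right (S : FourTerm l f q) [FiniteDimensional ℝ F] {p : List E} {y : List F}
    (hp : lamList (p.map (LinearMap.range l).mkQ) ≠ 0) (hy : lamList (y.map q) ≠ 0) :
    lamList (p.map f ++ y) ≠ 0 := by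
  have := S.ses_right.lamList_append_ne_zero hp hy
  rw [List.map_map] at this
  exact this

variable [FiniteDimensional ℝ E] [FiniteDimensional ℝ F]

/-- The factor `p` occurs once in `λ(E)` and once inside the dual of `λ(F)`, so rescaling it changes
nothing, while `x` and `y` scale alike on both sides. Hence prescribing the value at one choice of
generators is enough. -/
theorem exists_red (S : FourTerm l f q) (s : ℝ) :
    ∃ R : Lam E ⊗[ℝ] Module.Dual ℝ (Lam F) →ₗ[ℝ] Lam K ⊗[ℝ] Module.Dual ℝ (Lam C),
      ∀ x p y, x ≠ 0 → p ≠ 0 → y ≠ 0 →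
        R (S.ses_left.wedge x p ⊗ₜ dualElt (S.ses_right.wedge p y)) = s • (x ⊗ₜ dualElt y) := by
  have := S.finite_left
  have := S.finite_right
  obtain ⟨x, hx⟩ := exists_ne_zero_of_line (finrank_lam (V := K))
  obtain ⟨p, hp⟩ := exists_ne_zero_of_line (finrank_lam (V := E ⧸ LinearMap.range l))
  obtain ⟨y, hy⟩ := exists_ne_zero_of_line (finrank_lam (V := C))
  have hxp := S.ses_left.wedge_ne_zero hx hp
  have hpy := S.ses_right.wedge_ne_zero hp hy
  refine ⟨(dualElt (S.ses_left.wedge x p ⊗ₜ dualElt (S.ses_right.wedge p y))).smulRight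
    (s • (x ⊗ₜ dualElt y)), ?_⟩
  intro x1 p1 y1 hx1 hp1 hy1
  obtain ⟨a, rfl⟩ := eq_smul_of_line finrank_lam hx x1
  obtain ⟨b, rfl⟩ := eq_smul_of_line finrank_lam hp p1
  obtain ⟨c, rfl⟩ := eq_smul_of_line finrank_lam hy y1
  have hb := left_ne_zero_of_smul hp1
  have hc := left_ne_zero_of_smul hy1
  have h1 : S.ses_left.wedge (a • x) (b • p) = (a * b) • S.ses_left.wedge x p := by
    simp [smul_smul, mul_comm]
  have h2 : S.ses_right.wedge (b • p) (c • y) = (b * c) • S.ses_right.wedge p y := by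
    simp [smul_smul, mul_comm]
  rw [h1, h2, dualElt_smul finrank_lam hpy (mul_ne_zero hb hc), dualElt_smul finrank_lam hy hc]
  simp only [← TensorProduct.smul_tmul', TensorProduct.tmul_smul, smul_smul, map_smul,
    LinearMap.smulRight_apply, dualElt_self (tmul_ne_zero hxp (dualElt_ne_zero hpy))]
  congr 1
  field_simp

/-- The isomorphism `λ(E) ⊗ λ(F)^* → λ(K) ⊗ λ(C)^*` of an exact sequence
`0 → K → E → F → C → 0`, `(x ∧ p) ⊗ (f p ∧ y)^* ↦ (-1)^{rk f (dim F + 1)} x ⊗ y^*`. -/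
noncomputable def red (S : FourTerm l f q) :
    Lam E ⊗[ℝ] Module.Dual ℝ (Lam F) →ₗ[ℝ] Lam K ⊗[ℝ] Module.Dual ℝ (Lam C) :=
  (S.exists_red ((-1) ^ (Module.finrank ℝ (E ⧸ LinearMap.range l) *
    (Module.finrank ℝ F + 1)))).choose

/-- The form of `red` used for computations: `x` is a basis of the kernel, `p` completes it to a
basis of `E`, and `y` completes `f p` to a basis of `F`. That `x`, `p` and `y` are nonzero in their
lines follows from the two wedges being nonzero. -/
theorem red_lamList (S : FourTerm l f q) {x : List K} {p : List E} {y : List F}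
    (hx : x.length = Module.finrank ℝ K) (hxp : lamList (x.map l ++ p) ≠ 0)
    (hpy : lamList (p.map f ++ y) ≠ 0) :
    S.red (lamList (x.map l ++ p) ⊗ₜ dualElt (lamList (p.map f ++ y))) =
      (-1 : ℝ) ^ (p.length * (Module.finrank ℝ F + 1)) •
        (lamList x ⊗ₜ dualElt (lamList (y.map q))) := by
  have hx0 := S.ses_left.lamList_ne_zero_left hx hxp
  have hp0 := S.ses_left.lamList_ne_zero_right hx hxp
  have hp := length_of_lamList_ne_zero hp0
  have e : p.map f = (p.map (LinearMap.range l).mkQ).map (bar l f S.exact_left) := by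
    rw [List.map_map]; rfl
  rw [e] at hpy ⊢
  have hy0 := S.ses_right.lamList_ne_zero_right hp hpy
  rw [← S.ses_right.wedge_lamList hp, ← S.ses_left.wedge_lamList hx, red,
    (S.exists_red _).choose_spec _ _ _ hx0 hp0 hy0, ← hp, List.length_map]

theorem exists_lists (S : FourTerm l f q) : ∃ (x : List K) (p : List E) (y : List F),
    lamList x ≠ 0 ∧ lamList (x.map l ++ p) ≠ 0 ∧ lamList (p.map f ++ y) ≠ 0 ∧
      lamList (y.map q) ≠ 0 := by
  have := S.finite_left
  have := S.finite_right
  obtain ⟨x, hx⟩ := exists_lamList_ne_zero (V := K)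
  obtain ⟨p, hp⟩ := exists_lamList_map_ne_zero (LinearMap.range l).mkQ_surjective
  obtain ⟨y, hy⟩ := exists_lamList_map_ne_zero S.surj
  exact ⟨x, p, y, hx, S.lamList_ne_zero_left hx hp, S.lamList_ne_zero_right hp hy, hy⟩

/-- Ensures that elements of the form `red (α ⊗ β^*)` generate determinant lines, so that linear
maps may be compared on them. -/
theorem red_ne_zero (S : FourTerm l f q) {z : Lam E ⊗[ℝ] Module.Dual ℝ (Lam F)} (hz : z ≠ 0) :
    S.red z ≠ 0 := by
  obtain ⟨x, p, y, hx, hxp, hpy, hy⟩ := S.exists_lists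
  have hline : Module.finrank ℝ (Lam E ⊗[ℝ] Module.Dual ℝ (Lam F)) = 1 := by
    rw [Module.finrank_tensorProduct, Subspace.dual_finrank_eq, finrank_lam, finrank_lam]
  obtain ⟨c, rfl⟩ := eq_smul_of_line hline (tmul_ne_zero hxp (dualElt_ne_zero hpy)) z
  rw [map_smul, S.red_lamList (length_of_lamList_ne_zero hx) hxp hpy]
  exact smul_ne_zero (left_ne_zero_of_smul hz) (smul_ne_zero (neg_one_pow_ne_zero _)
    (tmul_ne_zero hx (dualElt_ne_zero hy)))

end FourTerm

end FourTerm

/-! ### Finite-dimensional approximations of an operator -/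

section Approx

variable {X Y E F : Type*} [NormedAddCommGroup X] [NormedSpace ℝ X]
  [NormedAddCommGroup Y] [NormedSpace ℝ Y] [AddCommGroup E] [Module ℝ E]
  [AddCommGroup F] [Module ℝ F]

/-- A linear map `f : E → F` which is the restriction of `D : X → Y` to a subspace `F` of `Y`
transverse to `D` and its preimage `E`. -/
structure Approx (D : X →L[ℝ] Y) (g : E →ₗ[ℝ] X) (h : F →ₗ[ℝ] Y) (f : E →ₗ[ℝ] F) : Prop where
  inj_left : Function.Injective g
  inj_right : Function.Injective h
  comm : ∀ e, h (f e) = D (g e)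
  exists_preimage : ∀ x b, D x = h b → ∃ e, g e = x
  transverse : ∀ y, ∃ x b, y = D x + h b

namespace Approx

variable {D : X →L[ℝ] Y} {g : E →ₗ[ℝ] X} {h : F →ₗ[ℝ] Y} {f : E →ₗ[ℝ] F}

/-- The inclusion `κ(D) → E`. -/
noncomputable def kerMap (A : Approx D g h f) : Ker D →ₗ[ℝ] E :=
  (LinearEquiv.ofInjective g A.inj_left).symm.toLinearMap ∘ₗ
    (LinearMap.ker D.toLinearMap).subtype.codRestrict (LinearMap.range g) fun x => by
      obtain ⟨e, he⟩ := A.exists_preimage x.1 0 (by rw [map_zero]; exact x.2)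
      exact ⟨e, he⟩

theorem map_kerMap (A : Approx D g h f) (x : Ker D) : g (A.kerMap x) = x.1 := by
  have := LinearEquiv.apply_symm_apply (LinearEquiv.ofInjective g A.inj_left)
    ((LinearMap.ker D.toLinearMap).subtype.codRestrict (LinearMap.range g) (fun x => by
      obtain ⟨e, he⟩ := A.exists_preimage x.1 0 (by rw [map_zero]; exact x.2)
      exact ⟨e, he⟩) x)
  exact congrArg Subtype.val this

/-- The projection `F → 𝔠(D)`. -/
noncomputable def cokMap (_ : Approx D g h f) : F →ₗ[ℝ] Coker D :=
  (LinearMap.range D.toLinearMap).mkQ ∘ₗ h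

theorem cokMap_apply (A : Approx D g h f) (b : F) :
    A.cokMap b = Submodule.Quotient.mk (h b) := rfl

/-- Exactness at `F` holds because every `x` with `D x` in `F` comes from `E`; surjectivity onto the
cokernel is transversality. -/
theorem fourTerm (A : Approx D g h f) : FourTerm A.kerMap f A.cokMap where
  inj x y hxy := Subtype.ext (by rw [← A.map_kerMap, hxy, A.map_kerMap])
  exact_left e := by
    constructor
    · intro he
      refine ⟨⟨g e, ?_⟩, A.inj_left (A.map_kerMap _)⟩
      exact (A.comm e).symm.trans (by rw [he, map_zero])
    · rintro ⟨x, rfl⟩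
      apply A.inj_right
      rw [A.comm, A.map_kerMap, map_zero]
      exact x.2
  exact_right b := by
    rw [cokMap_apply, Submodule.Quotient.mk_eq_zero]
    constructor
    · rintro ⟨x, hx⟩
      obtain ⟨e, rfl⟩ := A.exists_preimage x b hx
      exact ⟨e, A.inj_right ((A.comm e).trans hx)⟩
    · rintro ⟨e, rfl⟩
      exact ⟨g e, (A.comm e).symm⟩
  surj y := by
    induction y using Submodule.Quotient.induction_on with
    | _ y =>
    obtain ⟨x, b, rfl⟩ := A.transverse y
    refine ⟨b, ?_⟩
    rw [cokMap_apply, Submodule.Quotient.eq]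
    exact ⟨-x, by simp⟩

end Approx

end Approx

/-! ### The isomorphism `Ψ` in bases -/

namespace FredTriple

section

variable {X' X X'' Y' Y Y'' : Type*}
  [NormedAddCommGroup X'] [NormedSpace ℝ X'] [NormedAddCommGroup X] [NormedSpace ℝ X]
  [NormedAddCommGroup X''] [NormedSpace ℝ X''] [NormedAddCommGroup Y'] [NormedSpace ℝ Y']
  [NormedAddCommGroup Y] [NormedSpace ℝ Y] [NormedAddCommGroup Y''] [NormedSpace ℝ Y'']
  (t : FredTriple X' X X'' Y' Y Y'')

theorem delta_apply (v : Ker t.D'') (x : X) (y' : Y') (hx : t.jX x = v.1)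
    (hy : t.iY y' = t.D x) : t.delta v = Submodule.Quotient.mk y' :=
  SnakeLemma.δ'_eq _ _ _ _ _ _ _ _ _ _ _ _ _ _ _ _ _ v x hx y' hy

/-- Since `ker δ = jX(κ(D))`, the rank of `δ` in the exponent `ε_t` can be read off as the length of
the list `v`. -/
theorem finrank_range_delta : Module.finrank ℝ (LinearMap.range t.delta) =
    Module.finrank ℝ (Ker t.D'' ⧸ LinearMap.range t.kerJ) := by
  rw [← t.exact_kerJ_delta.linearMap_ker_eq]
  exact t.delta.quotKerEquivRange.finrank_eq.symm

variable {t} {x : List (Ker t.D')} {u : List (Ker t.D)} {v : List (Ker t.D'')}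
  {w : List (Coker t.D')} {y : List (Coker t.D)}

theorem wedgeKer_lamList (hx : lamList x ≠ 0) :
    t.wedgeKer (lamList x) (lamList (u.map (LinearMap.range t.kerI).mkQ)) =
      lamList (x.map t.kerI ++ u) :=
  (isSES_mkQ t.kerI_injective).wedge_lamList (length_of_lamList_ne_zero hx)

theorem wedgeKer''_lamList (hu : lamList (u.map (LinearMap.range t.kerI).mkQ) ≠ 0) :
    t.wedgeKer'' (lamList (u.map (LinearMap.range t.kerI).mkQ))
      (lamList (v.map (LinearMap.range t.kerJ).mkQ)) = lamList (u.map t.kerJ ++ v) := by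
  refine ((isSES_bar t.exact_ker).wedge_lamList (length_of_lamList_ne_zero hu)).trans ?_
  rw [List.map_map]
  rfl

theorem wedgeCok'_lamList (hv : lamList (v.map (LinearMap.range t.kerJ).mkQ) ≠ 0) :
    t.wedgeCok' (lamList (v.map (LinearMap.range t.kerJ).mkQ))
      (lamList (w.map (LinearMap.range t.delta).mkQ)) = lamList (v.map t.delta ++ w) := by
  refine ((isSES_bar t.exact_kerJ_delta).wedge_lamList (length_of_lamList_ne_zero hv)).trans ?_
  rw [List.map_map]
  rfl

theorem wedgeCok_lamList (hw : lamList (w.map (LinearMap.range t.delta).mkQ) ≠ 0) :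
    t.wedgeCok (lamList (w.map (LinearMap.range t.delta).mkQ))
      (lamList (y.map (LinearMap.range t.cokI).mkQ)) = lamList (w.map t.cokI ++ y) := by
  refine ((isSES_bar t.exact_delta_cokI).wedge_lamList (length_of_lamList_ne_zero hw)).trans ?_
  rw [List.map_map]
  rfl

theorem lamMap_cokEquiv_lamList :
    lamMap t.cokEquiv (lamList (y.map (LinearMap.range t.cokI).mkQ)) = lamList (y.map t.cokJ) := by
  rw [lamMap_lamList, List.map_map]
  rfl

theorem lamList_ker_ne_zero (hx : lamList x ≠ 0)
    (hu : lamList (u.map (LinearMap.range t.kerI).mkQ) ≠ 0) :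
    lamList (x.map t.kerI ++ u) ≠ 0 :=
  (isSES_mkQ t.kerI_injective).lamList_append_ne_zero hx hu

theorem lamList_ker''_ne_zero (hu : lamList (u.map (LinearMap.range t.kerI).mkQ) ≠ 0)
    (hv : lamList (v.map (LinearMap.range t.kerJ).mkQ) ≠ 0) :
    lamList (u.map t.kerJ ++ v) ≠ 0 := by
  rw [← wedgeKer''_lamList hu]
  exact (isSES_bar t.exact_ker).wedge_ne_zero hu hv

theorem lamList_cok'_ne_zero (hv : lamList (v.map (LinearMap.range t.kerJ).mkQ) ≠ 0)
    (hw : lamList (w.map (LinearMap.range t.delta).mkQ) ≠ 0) :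
    lamList (v.map t.delta ++ w) ≠ 0 := by
  rw [← wedgeCok'_lamList hv]
  exact (isSES_bar t.exact_kerJ_delta).wedge_ne_zero hv hw

theorem lamList_cok''_ne_zero (hy : lamList (y.map (LinearMap.range t.cokI).mkQ) ≠ 0) :
    lamList (y.map t.cokJ) ≠ 0 := by
  rw [← lamMap_cokEquiv_lamList]
  exact fun h0 => hy (lamMap_injective _ (h0.trans (map_zero _).symm))

theorem lamList_cok_ne_zero (hw : lamList (w.map (LinearMap.range t.delta).mkQ) ≠ 0)
    (hy : lamList (y.map (LinearMap.range t.cokI).mkQ) ≠ 0) :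
    lamList (w.map t.cokI ++ y) ≠ 0 := by
  rw [← wedgeCok_lamList hw]
  exact (isSES_bar t.exact_delta_cokI).wedge_ne_zero hw hy

theorem Psi_lamList (hx : lamList x ≠ 0)
    (hu : lamList (u.map (LinearMap.range t.kerI).mkQ) ≠ 0)
    (hv : lamList (v.map (LinearMap.range t.kerJ).mkQ) ≠ 0)
    (hw : lamList (w.map (LinearMap.range t.delta).mkQ) ≠ 0)
    (hy : lamList (y.map (LinearMap.range t.cokI).mkQ) ≠ 0) :
    t.Psi ((lamList x ⊗ₜ dualElt (lamList (v.map t.delta ++ w))) ⊗ₜ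
        (lamList (u.map t.kerJ ++ v) ⊗ₜ dualElt (lamList (y.map t.cokJ)))) =
      ((-1 : ℝ) ^ t.eps) •
        (lamList (x.map t.kerI ++ u) ⊗ₜ dualElt (lamList (w.map t.cokI ++ y))) := by
  rw [← wedgeCok'_lamList hv, ← wedgeKer''_lamList hu, ← lamMap_cokEquiv_lamList,
    ← wedgeKer_lamList hx, ← wedgeCok_lamList hw]
  exact t.isPsi_Psi _ _ _ _ _ hx hu hv hw hy

/-- By exactness of the six-term sequence, `|u| + |v| = dim κ(D'')`, `|v| + |w| = dim 𝔠(D')`, `|w| +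
|y| = dim 𝔠(D)`, `|y| = dim 𝔠(D'')` and `|v| = dim im δ`. Modulo 2 the difference in the index
becomes a sum. -/
theorem neg_one_pow_eps
    (hu : lamList (u.map (LinearMap.range t.kerI).mkQ) ≠ 0)
    (hv : lamList (v.map (LinearMap.range t.kerJ).mkQ) ≠ 0)
    (hw : lamList (w.map (LinearMap.range t.delta).mkQ) ≠ 0)
    (hy : lamList (y.map (LinearMap.range t.cokI).mkQ) ≠ 0) :
    (-1 : ℝ) ^ t.eps = (-1) ^ ((u.length + v.length + y.length) * (v.length + w.length) +
      (w.length + y.length) * v.length) := by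
  have h1 := length_of_lamList_ne_zero (lamList_ker''_ne_zero hu hv)
  have h2 := length_of_lamList_ne_zero (lamList_cok'_ne_zero hv hw)
  have h3 := length_of_lamList_ne_zero (lamList_cok''_ne_zero hy)
  have h4 := length_of_lamList_ne_zero (lamList_cok_ne_zero hw hy)
  have h5 := length_of_lamList_ne_zero hv
  apply neg_one_zpow_congr
  rw [eps, ind, finrank_range_delta, ← h1, ← h2, ← h3, ← h4, ← h5]
  simp only [List.length_append, List.length_map]
  push_cast
  rw [sub_eq_add_neg, ZMod.neg_eq_self_mod_two]

end

end FredTriple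

/-! ### `Ψ` in terms of approximations -/

section ApproxTriple

variable {X' X X'' Y' Y Y'' : Type*}
  [NormedAddCommGroup X'] [NormedSpace ℝ X'] [NormedAddCommGroup X] [NormedSpace ℝ X]
  [NormedAddCommGroup X''] [NormedSpace ℝ X''] [NormedAddCommGroup Y'] [NormedSpace ℝ Y']
  [NormedAddCommGroup Y] [NormedSpace ℝ Y] [NormedAddCommGroup Y''] [NormedSpace ℝ Y'']
  {t : FredTriple X' X X'' Y' Y Y''}
  {E' E E'' F' F F'' : Type*} [AddCommGroup E'] [Module ℝ E'] [AddCommGroup E] [Module ℝ E]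
  [AddCommGroup E''] [Module ℝ E''] [AddCommGroup F'] [Module ℝ F'] [AddCommGroup F] [Module ℝ F]
  [AddCommGroup F''] [Module ℝ F'']
  {g' : E' →ₗ[ℝ] X'} {h' : F' →ₗ[ℝ] Y'} {f' : E' →ₗ[ℝ] F'}
  {g : E →ₗ[ℝ] X} {h : F →ₗ[ℝ] Y} {f : E →ₗ[ℝ] F}
  {g'' : E'' →ₗ[ℝ] X''} {h'' : F'' →ₗ[ℝ] Y''} {f'' : E'' →ₗ[ℝ] F''}

/-- Restrictions of the operators of an exact triple that themselves form an exact triple, with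
rows `0 → E' → E → E'' → 0` and `0 → F' → F → F'' → 0`. -/
structure ApproxTriple (t : FredTriple X' X X'' Y' Y Y'') (g' : E' →ₗ[ℝ] X') (h' : F' →ₗ[ℝ] Y')
    (f' : E' →ₗ[ℝ] F') (g : E →ₗ[ℝ] X) (h : F →ₗ[ℝ] Y) (f : E →ₗ[ℝ] F)
    (g'' : E'' →ₗ[ℝ] X'') (h'' : F'' →ₗ[ℝ] Y'') (f'' : E'' →ₗ[ℝ] F'')
    (iE : E' →ₗ[ℝ] E) (jE : E →ₗ[ℝ] E'') (iF : F' →ₗ[ℝ] F) (jF : F →ₗ[ℝ] F'') : Prop where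
  approx' : Approx t.D' g' h' f'
  approx : Approx t.D g h f
  approx'' : Approx t.D'' g'' h'' f''
  sesE : IsSES iE jE
  sesF : IsSES iF jF
  comm_iE : ∀ e, g (iE e) = t.iX (g' e)
  comm_jE : ∀ e, g'' (jE e) = t.jX (g e)
  comm_iF : ∀ b, h (iF b) = t.iY (h' b)
  comm_jF : ∀ b, h'' (jF b) = t.jY (h b)

namespace ApproxTriple

variable {iE : E' →ₗ[ℝ] E} {jE : E →ₗ[ℝ] E''} {iF : F' →ₗ[ℝ] F} {jF : F →ₗ[ℝ] F''}
  (T : ApproxTriple t g' h' f' g h f g'' h'' f'' iE jE iF jF)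

include T

theorem f_iE (e : E') : f (iE e) = iF (f' e) := by
  apply T.approx.inj_right
  rw [T.approx.comm, T.comm_iE, T.comm_iF, T.approx'.comm, t.comm_i_apply]

theorem f_jE (e : E) : f'' (jE e) = jF (f e) := by
  apply T.approx''.inj_right
  rw [T.approx''.comm, T.comm_jE, T.comm_jF, T.approx.comm, t.comm_j_apply]

theorem kerMap_kerI (x : Ker t.D') : T.approx.kerMap (t.kerI x) = iE (T.approx'.kerMap x) := by
  apply T.approx.inj_left
  rw [T.approx.map_kerMap, T.comm_iE, T.approx'.map_kerMap]
  rfl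

theorem kerMap_kerJ (x : Ker t.D) : T.approx''.kerMap (t.kerJ x) = jE (T.approx.kerMap x) := by
  apply T.approx''.inj_left
  rw [T.approx''.map_kerMap, T.comm_jE, T.approx.map_kerMap]
  rfl

theorem cokMap_iF (b : F') : T.approx.cokMap (iF b) = t.cokI (T.approx'.cokMap b) := by
  rw [Approx.cokMap_apply, T.comm_iF]
  rfl

theorem cokMap_jF (b : F) : T.approx''.cokMap (jF b) = t.cokJ (T.approx.cokMap b) := by
  rw [Approx.cokMap_apply, T.comm_jF]
  rfl

/-- The snake construction of `δ` can be carried out inside the approximating rows: lift to `E`,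
apply `f`, and pull back to `F'`. -/
theorem exists_lift_delta (v : Ker t.D'') : ∃ (e : E) (z : F'),
    jE e = T.approx''.kerMap v ∧ f e = iF z ∧ T.approx'.cokMap z = t.delta v := by
  obtain ⟨e, he⟩ := T.sesE.surj (T.approx''.kerMap v)
  have h0 : jF (f e) = 0 := by
    rw [← T.f_jE, he]
    exact T.approx''.fourTerm.exact_left.apply_apply_eq_zero v
  obtain ⟨z, hz⟩ := (T.sesF.exact _).1 h0
  refine ⟨e, z, he, hz.symm, (t.delta_apply v (g e) (h' z) ?_ ?_).symm⟩
  · rw [← T.comm_jE, he, T.approx''.map_kerMap]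
  · rw [← T.comm_iF, hz, T.approx.comm]

variable [FiniteDimensional ℝ E'] [FiniteDimensional ℝ E] [FiniteDimensional ℝ E'']
  [FiniteDimensional ℝ F'] [FiniteDimensional ℝ F] [FiniteDimensional ℝ F'']

-- One generator is computed in bases adapted to all three columns and to the six-term sequence.
-- Besides `x, u, v, w, y` from the definition of `Ψ`, take `p'` in `E'` and `p` in `E` representing
-- bases of `E' / κ(D')` and `E'' / κ(D'')`. The bases are then `x, p'` of `E'`; `u, v, p` of `E''`;
-- `x, u, p', e(v), p` of `E`; `f' p', z(v), w` of `F'`; `f'' p, y` of `F''`; and `f p', f e(v), f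
-- p, w, y` of `F`, up to the evident maps.
set_option maxHeartbeats 2000000 in
theorem exists_psi_red : ∃ (α' : Lam E') (α'' : Lam E'') (β' : Lam F') (β'' : Lam F''),
    α' ≠ 0 ∧ α'' ≠ 0 ∧ β' ≠ 0 ∧ β'' ≠ 0 ∧
    t.Psi (T.approx'.fourTerm.red (α' ⊗ₜ dualElt β') ⊗ₜ
        T.approx''.fourTerm.red (α'' ⊗ₜ dualElt β'')) =
      (-1 : ℝ) ^ ((Module.finrank ℝ E'' + Module.finrank ℝ F'') * Module.finrank ℝ F') •
        T.approx.fourTerm.red (T.sesE.wedge α' α'' ⊗ₜ dualElt (T.sesF.wedge β' β'')) := by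
  have S' := T.approx'.fourTerm
  have S := T.approx.fourTerm
  have S'' := T.approx''.fourTerm
  obtain ⟨x, hx⟩ := exists_lamList_ne_zero (V := Ker t.D')
  obtain ⟨u, hu⟩ := exists_lamList_map_ne_zero (LinearMap.range t.kerI).mkQ_surjective
  obtain ⟨v, hv⟩ := exists_lamList_map_ne_zero (LinearMap.range t.kerJ).mkQ_surjective
  obtain ⟨w, hw⟩ := exists_lamList_map_ne_zero
    (j := (LinearMap.range t.delta).mkQ ∘ₗ T.approx'.cokMap)
    ((LinearMap.range t.delta).mkQ_surjective.comp S'.surj)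
  obtain ⟨y, hy⟩ := exists_lamList_map_ne_zero
    (j := (LinearMap.range t.cokI).mkQ ∘ₗ T.approx.cokMap)
    ((LinearMap.range t.cokI).mkQ_surjective.comp S.surj)
  obtain ⟨p', hp'⟩ := exists_lamList_map_ne_zero
    (LinearMap.range T.approx'.kerMap).mkQ_surjective
  obtain ⟨p, hp⟩ := exists_lamList_map_ne_zero
    (j := (LinearMap.range T.approx''.kerMap).mkQ ∘ₗ jE)
    ((LinearMap.range T.approx''.kerMap).mkQ_surjective.comp T.sesE.surj)
  -- `e v` lifts `v` to `E`, and `z v` represents `δ v` in `F'`. The relation `f (e v) = iF (z v)`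
  -- is why the block `v` belongs to the kernel for `D''` but to the complement of the kernel for
  -- `D`.
  choose e z he hz hδ using T.exists_lift_delta
  rw [LinearMap.coe_comp, ← List.map_map] at hw hy hp
  have hvz : (v.map z ++ w).map T.approx'.cokMap = v.map t.delta ++ w.map T.approx'.cokMap := by
    rw [List.map_append, List.map_map]
    congr 1
    exact List.map_congr_left fun a _ => hδ a
  have hyj : (y.map jF).map T.approx''.cokMap = (y.map T.approx.cokMap).map t.cokJ := by
    rw [List.map_map, List.map_map]
    exact List.map_congr_left fun a _ => T.cokMap_jF a
  have hwi : (w.map iF ++ y).map T.approx.cokMap =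
      (w.map T.approx'.cokMap).map t.cokI ++ y.map T.approx.cokMap := by
    rw [List.map_append, List.map_map, List.map_map]
    congr 1
    exact List.map_congr_left fun a _ => T.cokMap_iF a
  have key := FredTriple.Psi_lamList hx hu hv hw hy
  have heps := FredTriple.neg_one_pow_eps hu hv hw hy
  have hker0 := FredTriple.lamList_ker_ne_zero hx hu
  have hker''0 := FredTriple.lamList_ker''_ne_zero hu hv
  have hcok'0 := FredTriple.lamList_cok'_ne_zero hv hw
  have hcoke0 := FredTriple.lamList_cok''_ne_zero hy
  rw [← hvz] at hcok'0 key
  rw [← hyj] at hcoke0 key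
  rw [← hwi] at key
  have hα' := S'.lamList_ne_zero_left hx hp'
  have hβ' := S'.lamList_ne_zero_right hp' hcok'0
  have hα'' := S''.lamList_ne_zero_left hker''0 hp
  have hβ'' := S''.lamList_ne_zero_right hp hcoke0
  -- The sign comes from moving the complement `p'` past the kernel vectors `u`.
  have hα : T.sesE.wedge (lamList (x.map T.approx'.kerMap ++ p'))
      (lamList ((u.map t.kerJ ++ v).map T.approx''.kerMap ++ p.map jE)) =
      (-1 : ℝ) ^ (p'.length * u.length) • lamList ((x.map t.kerI ++ u).map T.approx.kerMap ++
        (p'.map iE ++ (v.map e ++ p))) := by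
    have e1 : (u.map t.kerJ ++ v).map T.approx''.kerMap ++ p.map jE =
        (u.map T.approx.kerMap ++ (v.map e ++ p)).map jE := by
      simp only [List.map_append, List.map_map, List.append_assoc]
      congr 1
      · exact List.map_congr_left fun a _ => T.kerMap_kerJ a
      · congr 1
        exact List.map_congr_left fun a _ => (he a).symm
    have e2 : (x.map t.kerI).map T.approx.kerMap = (x.map T.approx'.kerMap).map iE := by
      rw [List.map_map, List.map_map]
      exact List.map_congr_left fun a _ => T.kerMap_kerI a
    rw [e1, T.sesE.wedge_lamList (length_of_lamList_ne_zero hα')]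
    simp only [List.map_append, List.append_assoc, e2]
    rw [lamList_swap, List.length_map, List.length_map]
  -- The sign comes from moving `w`, a cokernel block, past the image block of `p`.
  have hβ : T.sesF.wedge (lamList (p'.map f' ++ (v.map z ++ w)))
      (lamList ((p.map jE).map f'' ++ y.map jF)) =
      (-1 : ℝ) ^ (w.length * p.length) • lamList ((p'.map iE ++ (v.map e ++ p)).map f ++
        (w.map iF ++ y)) := by
    have e1 : (p.map jE).map f'' ++ y.map jF = (p.map f ++ y).map jF := by
      simp only [List.map_append, List.map_map]
      congr 1
      exact List.map_congr_left fun a _ => T.f_jE a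
    have e2 : (p'.map f').map iF = (p'.map iE).map f := by
      rw [List.map_map, List.map_map]
      exact List.map_congr_left fun a _ => (T.f_iE a).symm
    have e3 : (v.map z).map iF = (v.map e).map f := by
      rw [List.map_map, List.map_map]
      exact List.map_congr_left fun a _ => (hz a).symm
    rw [e1, T.sesF.wedge_lamList (length_of_lamList_ne_zero hβ')]
    simp only [List.map_append, List.append_assoc, e2, e3]
    rw [← List.append_assoc, lamList_swap, List.append_assoc, List.length_map, List.length_map]
  have hα0 := T.sesE.wedge_ne_zero hα' hα''
  have hβ0 := T.sesF.wedge_ne_zero hβ' hβ''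
  rw [hα] at hα0
  rw [hβ] at hβ0
  refine ⟨_, _, _, _, hα', hα'', hβ', hβ'', ?_⟩
  rw [S'.red_lamList (length_of_lamList_ne_zero hx) hα' hβ',
    S''.red_lamList (length_of_lamList_ne_zero hker''0) hα'' hβ'', hα, hβ,
    dualElt_smul finrank_lam (right_ne_zero_of_smul hβ0) (left_ne_zero_of_smul hβ0)]
  simp only [← TensorProduct.smul_tmul', TensorProduct.tmul_smul, map_smul]
  rw [key, S.red_lamList (length_of_lamList_ne_zero hker0) (right_ne_zero_of_smul hα0)
    (right_ne_zero_of_smul hβ0)]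
  simp only [smul_smul, neg_one_pow_inv]
  congr 1
  rw [heps, ← length_of_lamList_ne_zero hα'', ← length_of_lamList_ne_zero hβ'',
    ← length_of_lamList_ne_zero hβ', ← length_of_lamList_ne_zero (right_ne_zero_of_smul hβ0)]
  simp only [← pow_add, List.length_append, List.length_map]
  -- What remains is the cancellation of the three `red` signs, the two reordering signs and `ε_t`
  -- against `(dim E'' + dim F'') dim F'`, as polynomials in the six list lengths.
  apply neg_one_pow_congr
  push_cast
  generalize (u.length : ZMod 2) = a1
  generalize (v.length : ZMod 2) = a2
  generalize (w.length : ZMod 2) = a3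
  generalize (y.length : ZMod 2) = a4
  generalize (p.length : ZMod 2) = a5
  generalize (p'.length : ZMod 2) = a6
  revert a1 a2 a3 a4 a5 a6
  decide

set_option maxHeartbeats 2000000 in
/-- The isomorphism `Ψ` in terms of the restrictions of the operators:
`(α' ⊗ β'^*) ⊗ (α'' ⊗ β''^*) ↦ (-1)^{(ind D'') dim F'} (α' ∧ α'') ⊗ (β' ∧ β'')^*`. -/
theorem psi_red {α' : Lam E'} {α'' : Lam E''} {β' : Lam F'} {β'' : Lam F''}
    (hβ' : β' ≠ 0) (hβ'' : β'' ≠ 0) :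
    t.Psi (T.approx'.fourTerm.red (α' ⊗ₜ dualElt β') ⊗ₜ
        T.approx''.fourTerm.red (α'' ⊗ₜ dualElt β'')) =
      (-1 : ℝ) ^ ((Module.finrank ℝ E'' + Module.finrank ℝ F'') * Module.finrank ℝ F') •
        T.approx.fourTerm.red (T.sesE.wedge α' α'' ⊗ₜ dualElt (T.sesF.wedge β' β'')) := by
  -- Both sides scale by `c1 c2 / (c3 c4)`, so the one generator already treated suffices.
  obtain ⟨a', a'', b', b'', ha', ha'', hb', hb'', key⟩ := T.exists_psi_red
  obtain ⟨c1, rfl⟩ := eq_smul_of_line finrank_lam ha' α'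
  obtain ⟨c2, rfl⟩ := eq_smul_of_line finrank_lam ha'' α''
  obtain ⟨c3, rfl⟩ := eq_smul_of_line finrank_lam hb' β'
  obtain ⟨c4, rfl⟩ := eq_smul_of_line finrank_lam hb'' β''
  have h3 := left_ne_zero_of_smul hβ'
  have h4 := left_ne_zero_of_smul hβ''
  have h5 : T.sesF.wedge (c3 • b') (c4 • b'') = (c4 * c3) • T.sesF.wedge b' b'' := by
    simp only [map_smul, LinearMap.smul_apply, smul_smul]
  rw [h5, dualElt_smul finrank_lam (T.sesF.wedge_ne_zero hb' hb'') (mul_ne_zero h4 h3),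
    dualElt_smul finrank_lam hb' h3, dualElt_smul finrank_lam hb'' h4]
  simp only [← TensorProduct.smul_tmul', TensorProduct.tmul_smul, map_smul, LinearMap.smul_apply,
    key, smul_smul]
  congr 1
  ring

end ApproxTriple

end ApproxTriple

/-! ### Direct sums and lists -/

section Products

variable {V W : Type*} [AddCommGroup V] [Module ℝ V] [AddCommGroup W] [Module ℝ W]

theorem isSES_inl_snd : IsSES (LinearMap.inl ℝ V W) (LinearMap.snd ℝ V W) where
  inj := LinearMap.inl_injective
  exact := Function.Exact.inl_snd
  surj := LinearMap.snd_surjective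

theorem isSES_inr_fst : IsSES (LinearMap.inr ℝ V W) (LinearMap.fst ℝ V W) where
  inj := LinearMap.inr_injective
  exact := Function.Exact.inr_fst
  surj := LinearMap.fst_surjective

/-- The version with the subspace basis on the right; the two transposition signs agree because `l`
and `m` have the same length. -/
theorem IsSES.lamList_append_congr_left {V' V'' : Type*} [AddCommGroup V'] [Module ℝ V']
    [AddCommGroup V''] [Module ℝ V''] {i : V' →ₗ[ℝ] V} {j : V →ₗ[ℝ] V''} (h : IsSES i j)
    [FiniteDimensional ℝ V] {l' : List V'} {l m : List V} (hl' : l'.length = Module.finrank ℝ V')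
    (hlm : l.map j = m.map j) : lamList (l ++ l'.map i) = lamList (m ++ l'.map i) := by
  have hlen : l.length = m.length := by simpa using congrArg List.length hlm
  rw [lamList_append_comm, h.lamList_append_congr hl' hlm, lamList_append_comm m, hlen]

end Products

/-! ### Composition as contraction -/

section Composition

variable {X₁ X₂ X₃ E₁ E₂ E₃ : Type*} [NormedAddCommGroup X₁] [NormedSpace ℝ X₁]
  [NormedAddCommGroup X₂] [NormedSpace ℝ X₂] [NormedAddCommGroup X₃] [NormedSpace ℝ X₃]
  [AddCommGroup E₁] [Module ℝ E₁] [AddCommGroup E₂] [Module ℝ E₂] [AddCommGroup E₃] [Module ℝ E₃]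
  {D₁ : X₁ →L[ℝ] X₂} {D₂ : X₂ →L[ℝ] X₃} {D₁₂ : X₁ →L[ℝ] X₃}
  {g₁ : E₁ →ₗ[ℝ] X₁} {g₂ : E₂ →ₗ[ℝ] X₂} {g₃ : E₃ →ₗ[ℝ] X₃}
  {f₁ : E₁ →ₗ[ℝ] E₂} {f₂ : E₂ →ₗ[ℝ] E₃} {f₁₂ : E₁ →ₗ[ℝ] E₃}

theorem Approx.prodMap_id (A : Approx D₁₂ g₁ g₃ f₁₂) (hg : Function.Injective g₂) :
    Approx (D₁₂.prodMap (ContinuousLinearMap.id ℝ X₂)) (g₁.prodMap g₂) (g₃.prodMap g₂)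
      (f₁₂.prodMap LinearMap.id) where
  inj_left := A.inj_left.prodMap hg
  inj_right := A.inj_right.prodMap hg
  comm e := Prod.ext (A.comm e.1) rfl
  exists_preimage x b hx := by
    obtain ⟨e, he⟩ := A.exists_preimage x.1 b.1 (congrArg Prod.fst hx)
    exact ⟨(e, b.2), Prod.ext he (congrArg Prod.snd hx).symm⟩
  transverse y := by
    obtain ⟨x, b, hy⟩ := A.transverse y.1
    exact ⟨(x, y.2), (b, 0), Prod.ext hy (by simp)⟩

/-- The approximating rows repeat the composition triple verbatim, with `f₁` and `f₂` in place of
`D₁` and `D₂`. -/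
theorem approxTriple_comp (h : D₂ ∘L D₁ = D₁₂) (h₁ : D₁.IsFredholm) (h₂ : D₂.IsFredholm)
    (A₁ : Approx D₁ g₁ g₂ f₁) (A₂ : Approx D₂ g₂ g₃ f₂) (A₁₂ : Approx D₁₂ g₁ g₃ f₁₂) :
    ApproxTriple (compTriple D₁ D₂ D₁₂ h h₁ h₂) g₁ g₂ f₁ (g₁.prodMap g₂) (g₃.prodMap g₂)
      (f₁₂.prodMap LinearMap.id) g₂ g₃ f₂ (LinearMap.id.prod f₁)
      (f₁ ∘ₗ LinearMap.fst ℝ E₁ E₂ - LinearMap.snd ℝ E₁ E₂) (f₂.prod LinearMap.id)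
      (LinearMap.fst ℝ E₃ E₂ - f₂ ∘ₗ LinearMap.snd ℝ E₃ E₂) where
  approx' := A₁
  approx := A₁₂.prodMap_id A₁.inj_right
  approx'' := A₂
  sesE :=
    { inj := fun x y hxy => congrArg Prod.fst hxy
      exact := fun ⟨a, b⟩ =>
        ⟨fun hab => ⟨a, Prod.ext rfl (sub_eq_zero.1 hab)⟩, by rintro ⟨x, hx⟩; rw [← hx]; simp⟩
      surj := fun x => ⟨(0, -x), by simp⟩ }
  sesF :=
    { inj := fun x y hxy => congrArg Prod.snd hxy
      exact := fun ⟨a, b⟩ =>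
        ⟨fun hab => ⟨b, Prod.ext (sub_eq_zero.1 hab).symm rfl⟩, by rintro ⟨x, hx⟩; rw [← hx]; simp⟩
      surj := fun x => ⟨(x, 0), by simp⟩ }
  comm_iE e := Prod.ext rfl (A₁.comm e)
  comm_jE e := by simp [compTriple, A₁.comm]
  comm_iF e := Prod.ext (A₂.comm e) rfl
  comm_jF e := by simp [compTriple, A₂.comm]

variable [FiniteDimensional ℝ E₁] [FiniteDimensional ℝ E₂] [FiniteDimensional ℝ E₃]

-- The identity summand maps the block `c` to itself, so `c` joins the complement `p` of the kernel.
-- The resulting change of the `red` sign is `(-1)^{|y||c|}`, which is exactly the cost of moving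
-- `c` past `y` in the target.
set_option maxHeartbeats 2000000 in
theorem sumIdMap_red (A : Approx D₁₂ g₁ g₃ f₁₂) (hg : Function.Injective g₂)
    {x : List (Ker D₁₂)} {p : List E₁} {y : List E₃} {c : List E₂} (hx : lamList x ≠ 0)
    (hc : lamList c ≠ 0) (hxp : lamList (x.map A.kerMap ++ p) ≠ 0)
    (hpy : lamList (p.map f₁₂ ++ y) ≠ 0) :
    sumIdMap X₂ D₁₂ ((A.prodMap_id hg).fourTerm.red
      (lamList ((x.map A.kerMap ++ p).map (LinearMap.inl ℝ E₁ E₂) ++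
          c.map (LinearMap.inr ℝ E₁ E₂)) ⊗ₜ
        dualElt (lamList ((p.map f₁₂ ++ y).map (LinearMap.inl ℝ E₃ E₂) ++
          c.map (LinearMap.inr ℝ E₃ E₂))))) =
      A.fourTerm.red (lamList (x.map A.kerMap ++ p) ⊗ₜ dualElt (lamList (p.map f₁₂ ++ y))) := by
  have hxl := length_of_lamList_ne_zero hx
  have hcl := length_of_lamList_ne_zero hc
  have hpyl := length_of_lamList_ne_zero hpy
  have hy : lamList (y.map A.cokMap) ≠ 0 := by
    have e : p.map f₁₂ = (p.map (LinearMap.range A.kerMap).mkQ).map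
        (bar A.kerMap f₁₂ A.fourTerm.exact_left) := by
      rw [List.map_map]; rfl
    rw [e] at hpy
    exact A.fourTerm.ses_right.lamList_ne_zero_right
      (length_of_lamList_ne_zero (A.fourTerm.ses_left.lamList_ne_zero_right hxl hxp)) hpy
  have hE0 : lamList ((x.map A.kerMap ++ p).map (LinearMap.inl ℝ E₁ E₂) ++
      c.map (LinearMap.inr ℝ E₁ E₂)) ≠ 0 := by
    refine isSES_inl_snd.lamList_append_ne_zero hxp ?_
    rw [List.map_map]
    simpa using hc
  have hF0 : lamList ((p.map f₁₂ ++ y).map (LinearMap.inl ℝ E₃ E₂) ++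
      c.map (LinearMap.inr ℝ E₃ E₂)) ≠ 0 := by
    refine isSES_inl_snd.lamList_append_ne_zero hpy ?_
    rw [List.map_map]
    simpa using hc
  have e1 : (x.map A.kerMap ++ p).map (LinearMap.inl ℝ E₁ E₂) ++ c.map (LinearMap.inr ℝ E₁ E₂) =
      (x.map (kerSumId X₂ D₁₂).symm).map (A.prodMap_id hg).kerMap ++
        (p.map (LinearMap.inl ℝ E₁ E₂) ++ c.map (LinearMap.inr ℝ E₁ E₂)) := by
    rw [List.map_append, List.append_assoc, List.map_map, List.map_map]
    congr 1
    refine List.map_congr_left fun a _ => (A.prodMap_id hg).inj_left ?_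
    refine Eq.trans ?_ ((A.prodMap_id hg).map_kerMap _).symm
    exact Prod.ext (A.map_kerMap a) (map_zero g₂)
  have e2 : lamList ((p.map f₁₂ ++ y).map (LinearMap.inl ℝ E₃ E₂) ++
      c.map (LinearMap.inr ℝ E₃ E₂)) = (-1 : ℝ) ^ (y.length * c.length) •
      lamList ((p.map (LinearMap.inl ℝ E₁ E₂) ++ c.map (LinearMap.inr ℝ E₁ E₂)).map
        (f₁₂.prodMap LinearMap.id) ++ y.map (LinearMap.inl ℝ E₃ E₂)) := by
    have h1 : (p.map (LinearMap.inl ℝ E₁ E₂)).map (f₁₂.prodMap LinearMap.id) =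
        (p.map f₁₂).map (LinearMap.inl ℝ E₃ E₂) := by
      rw [List.map_map, List.map_map]
      exact List.map_congr_left fun a _ => Prod.ext rfl rfl
    have h2 : (c.map (LinearMap.inr ℝ E₁ E₂)).map (f₁₂.prodMap LinearMap.id) =
        c.map (LinearMap.inr ℝ E₃ E₂) := by
      rw [List.map_map]
      exact List.map_congr_left fun a _ => Prod.ext (map_zero f₁₂) rfl
    simp only [List.map_append, h1, h2, List.append_assoc]
    have := lamList_swap ((p.map f₁₂).map (LinearMap.inl ℝ E₃ E₂))
      (y.map (LinearMap.inl ℝ E₃ E₂)) (c.map (LinearMap.inr ℝ E₃ E₂)) []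
    simpa only [List.append_nil, List.length_map] using this
  rw [e2] at hF0
  rw [e1] at hE0
  have e3 : (y.map (LinearMap.inl ℝ E₃ E₂)).map (A.prodMap_id hg).cokMap =
      (y.map A.cokMap).map (cokSumId X₂ D₁₂) := by
    rw [List.map_map, List.map_map]
    refine List.map_congr_left fun a _ => ?_
    change (Submodule.Quotient.mk (g₃ a, g₂ 0) : Coker _) = Submodule.Quotient.mk (g₃ a, 0)
    rw [map_zero]
  have e4 : (x.map (kerSumId X₂ D₁₂).symm).map (kerSumId X₂ D₁₂) = x := by
    rw [List.map_map]
    exact (List.map_congr_left fun a _ => (kerSumId X₂ D₁₂).apply_symm_apply a).trans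
      (List.map_id x)
  have := A.fourTerm.finite_right
  rw [e1, e2, dualElt_smul finrank_lam (right_ne_zero_of_smul hF0) (neg_one_pow_ne_zero _),
    TensorProduct.tmul_smul, map_smul, map_smul,
    (A.prodMap_id hg).fourTerm.red_lamList
      (by rw [List.length_map, hxl, (kerSumId X₂ D₁₂).finrank_eq]) hE0
      (right_ne_zero_of_smul hF0), map_smul, A.fourTerm.red_lamList hxl hxp hpy, e3, sumIdMap,
    TensorProduct.map_tmul, lamMap_lamList, e4, LinearMap.dualMap_apply',
    dualElt_lamList_comp_lamMap _ hy, smul_smul, neg_one_pow_inv, ← pow_add,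
    Module.finrank_prod, ← hpyl, ← hcl]
  congr 1
  simp only [List.length_append, List.length_map]
  apply neg_one_pow_congr
  push_cast
  generalize (y.length : ZMod 2) = a1
  generalize (p.length : ZMod 2) = a2
  generalize (c.length : ZMod 2) = a3
  revert a1 a2 a3
  decide

-- With `n₂ = dim E₂` and `n₃ = dim E₃`, the contributions are `(n₂ + n₃) n₂` from `Ψ`, `n₂` from
-- the minus sign in `(x₁, x₂) ↦ D₁ x₁ - x₂`, and `n₂ n₃` from the order of the summands of `X₃ ⊕
-- X₂`. Their sum is even.
set_option maxHeartbeats 2000000 in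
theorem compMap_red_lamList (h : D₂ ∘L D₁ = D₁₂) (h₁ : D₁.IsFredholm) (h₂ : D₂.IsFredholm)
    (A₁ : Approx D₁ g₁ g₂ f₁) (A₂ : Approx D₂ g₂ g₃ f₂) (A₁₂ : Approx D₁₂ g₁ g₃ f₁₂)
    {x : List (Ker D₁₂)} {p : List E₁} {y : List E₃} {c : List E₂} (hx : lamList x ≠ 0)
    (hc : lamList c ≠ 0) (hxp : lamList (x.map A₁₂.kerMap ++ p) ≠ 0)
    (hpy : lamList (p.map f₁₂ ++ y) ≠ 0) :
    compMap D₁ D₂ D₁₂ h h₁ h₂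
      (A₁.fourTerm.red (lamList (x.map A₁₂.kerMap ++ p) ⊗ₜ dualElt (lamList c)) ⊗ₜ
        A₂.fourTerm.red (lamList c ⊗ₜ dualElt (lamList (p.map f₁₂ ++ y)))) =
      A₁₂.fourTerm.red (lamList (x.map A₁₂.kerMap ++ p) ⊗ₜ dualElt (lamList (p.map f₁₂ ++ y))) := by
  have T := approxTriple_comp h h₁ h₂ A₁ A₂ A₁₂
  have key := T.psi_red (α' := lamList (x.map A₁₂.kerMap ++ p)) (α'' := lamList c) hc hpy
  have key2 := sumIdMap_red A₁₂ A₁.inj_right hx hc hxp hpy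
  set a := x.map A₁₂.kerMap ++ p with ha
  set b := p.map f₁₂ ++ y with hb
  have hal := length_of_lamList_ne_zero hxp
  have hbl := length_of_lamList_ne_zero hpy
  have hcl := length_of_lamList_ne_zero hc
  have hE : T.sesE.wedge (lamList a) (lamList c) = (-1 : ℝ) ^ c.length •
      lamList (a.map (LinearMap.inl ℝ E₁ E₂) ++ c.map (LinearMap.inr ℝ E₁ E₂)) := by
    -- The surjection sends `(0, -c)` to `c`, so the lift of `c` is taken with a minus sign.
    have h1 : c = ((c.map (LinearMap.inr ℝ E₁ E₂)).map Neg.neg).map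
        (f₁ ∘ₗ LinearMap.fst ℝ E₁ E₂ - LinearMap.snd ℝ E₁ E₂) := by
      rw [List.map_map, List.map_map]
      exact ((List.map_congr_left fun a _ => by simp).trans (List.map_id c)).symm
    have h2 : (c.map (LinearMap.inr ℝ E₁ E₂)).map Neg.neg =
        (c.map Neg.neg).map (LinearMap.inr ℝ E₁ E₂) := by
      rw [List.map_map, List.map_map]
      exact List.map_congr_left fun a _ => (map_neg (LinearMap.inr ℝ E₁ E₂) a).symm
    -- The graph vectors `(a, f₁ a)` may be replaced by `(a, 0)`, since the block `c` already fills
    -- `E₂`.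
    have h3 : (a.map (LinearMap.id.prod f₁)).map (LinearMap.fst ℝ E₁ E₂) =
        (a.map (LinearMap.inl ℝ E₁ E₂)).map (LinearMap.fst ℝ E₁ E₂) := by
      rw [List.map_map, List.map_map]
      rfl
    conv_lhs => rw [h1]
    rw [T.sesE.wedge_lamList hal, h2, isSES_inr_fst.lamList_append_congr_left (by simpa) h3, ← h2,
      lamList_append_neg, List.length_map]
  have hF : T.sesF.wedge (lamList c) (lamList b) = (-1 : ℝ) ^ (c.length * b.length) •
      lamList (b.map (LinearMap.inl ℝ E₃ E₂) ++ c.map (LinearMap.inr ℝ E₃ E₂)) := by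
    have h1 : b = (b.map (LinearMap.inl ℝ E₃ E₂)).map
        (LinearMap.fst ℝ E₃ E₂ - f₂ ∘ₗ LinearMap.snd ℝ E₃ E₂) := by
      rw [List.map_map]
      exact ((List.map_congr_left fun a _ => by simp).trans (List.map_id b)).symm
    -- Likewise `(f₂ c, c)` may be replaced by `(0, c)`, since `b` already fills `E₃`.
    have h3 : (c.map (f₂.prod LinearMap.id)).map (LinearMap.snd ℝ E₃ E₂) =
        (c.map (LinearMap.inr ℝ E₃ E₂)).map (LinearMap.snd ℝ E₃ E₂) := by
      rw [List.map_map, List.map_map]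
      rfl
    conv_lhs => rw [h1]
    rw [T.sesF.wedge_lamList hcl, lamList_append_comm, isSES_inl_snd.lamList_append_congr hbl h3,
      List.length_map, List.length_map]
  have hF0 := T.sesF.wedge_ne_zero hc hpy
  rw [hF] at hF0
  rw [hE, hF, dualElt_smul finrank_lam (right_ne_zero_of_smul hF0) (neg_one_pow_ne_zero _)] at key
  simp only [← TensorProduct.smul_tmul', TensorProduct.tmul_smul, map_smul, smul_smul,
    neg_one_pow_inv, ← pow_add] at key
  refine (congrArg (sumIdMap X₂ D₁₂) key).trans
    ((map_smul (sumIdMap X₂ D₁₂) _ _).trans ((congrArg (HSMul.hSMul _) key2).trans ?_))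
  rw [neg_one_pow_congr (n := 0), pow_zero, one_smul]
  rw [hbl, hcl]
  push_cast
  generalize (Module.finrank ℝ E₂ : ZMod 2) = a1
  generalize (Module.finrank ℝ E₃ : ZMod 2) = a2
  revert a1 a2
  decide

end Composition

section Composition

variable {X₁ X₂ X₃ E₁ E₂ E₃ : Type*} [NormedAddCommGroup X₁] [NormedSpace ℝ X₁]
  [NormedAddCommGroup X₂] [NormedSpace ℝ X₂] [NormedAddCommGroup X₃] [NormedSpace ℝ X₃]
  [AddCommGroup E₁] [Module ℝ E₁] [AddCommGroup E₂] [Module ℝ E₂] [AddCommGroup E₃] [Module ℝ E₃]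
  {D₁ : X₁ →L[ℝ] X₂} {D₂ : X₂ →L[ℝ] X₃} {D₁₂ : X₁ →L[ℝ] X₃}
  {g₁ : E₁ →ₗ[ℝ] X₁} {g₂ : E₂ →ₗ[ℝ] X₂} {g₃ : E₃ →ₗ[ℝ] X₃}
  {f₁ : E₁ →ₗ[ℝ] E₂} {f₂ : E₂ →ₗ[ℝ] E₃} {f₁₂ : E₁ →ₗ[ℝ] E₃}
  [FiniteDimensional ℝ E₁] [FiniteDimensional ℝ E₂] [FiniteDimensional ℝ E₃]

set_option maxHeartbeats 1000000 in
/-- In terms of restrictions to finite-dimensional spaces, the composition isomorphism is the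
contraction `(α ⊗ β^*) ⊗ (β ⊗ γ^*) ↦ α ⊗ γ^*`. -/
theorem compMap_red (h : D₂ ∘L D₁ = D₁₂) (h₁ : D₁.IsFredholm) (h₂ : D₂.IsFredholm)
    (A₁ : Approx D₁ g₁ g₂ f₁) (A₂ : Approx D₂ g₂ g₃ f₂) (A₁₂ : Approx D₁₂ g₁ g₃ f₁₂)
    {α : Lam E₁} {β : Lam E₂} {γ : Lam E₃} (hβ : β ≠ 0) (hγ : γ ≠ 0) :
    compMap D₁ D₂ D₁₂ h h₁ h₂ (A₁.fourTerm.red (α ⊗ₜ dualElt β) ⊗ₜ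
        A₂.fourTerm.red (β ⊗ₜ dualElt γ)) = A₁₂.fourTerm.red (α ⊗ₜ dualElt γ) := by
  obtain ⟨x, p, y, hx, hxp, hpy, -⟩ := A₁₂.fourTerm.exists_lists
  obtain ⟨c, hc⟩ := exists_lamList_ne_zero (V := E₂)
  have key := compMap_red_lamList h h₁ h₂ A₁ A₂ A₁₂ hx hc hxp hpy
  obtain ⟨c1, rfl⟩ := eq_smul_of_line finrank_lam hxp α
  obtain ⟨c2, rfl⟩ := eq_smul_of_line finrank_lam hc β
  obtain ⟨c3, rfl⟩ := eq_smul_of_line finrank_lam hpy γ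
  have h2 := left_ne_zero_of_smul hβ
  have h3 := left_ne_zero_of_smul hγ
  rw [dualElt_smul finrank_lam hc h2, dualElt_smul finrank_lam hpy h3]
  simp only [← TensorProduct.smul_tmul', TensorProduct.tmul_smul, map_smul, key, smul_smul]
  congr 1
  field_simp

end Composition

/-! ### Stabilization in terms of approximations -/

section Stabilization

variable {X Y E F : Type*} [NormedAddCommGroup X] [NormedSpace ℝ X]
  [NormedAddCommGroup Y] [NormedSpace ℝ Y] [AddCommGroup E] [Module ℝ E]
  [AddCommGroup F] [Module ℝ F] {D : X →L[ℝ] Y} {g : E →ₗ[ℝ] X} {h : F →ₗ[ℝ] Y} {f : E →ₗ[ℝ] F}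
  {N : ℕ}

theorem approx_incl (hg : Function.Injective g) :
    Approx (incl X N) g (g.prodMap LinearMap.id) (LinearMap.inl ℝ E (Fin N → ℝ)) where
  inj_left := hg
  inj_right := hg.prodMap Function.injective_id
  comm e := Prod.ext rfl rfl
  exists_preimage x b hx := ⟨b.1, (congrArg Prod.fst hx).symm⟩
  transverse y := ⟨y.1, (0, y.2), by simp [incl]⟩

/-- Because `Θ` takes values in `F`, the condition `D x + Θ u ∈ F` is the same as `D x ∈ F`. So the
target `F` is unchanged and its preimage is `E ⊕ ℝ^N`. -/
theorem Approx.stab (A : Approx D g h f) {Θ : (Fin N → ℝ) →L[ℝ] Y} {θ : (Fin N → ℝ) →ₗ[ℝ] F}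
    (hθ : ∀ u, h (θ u) = Θ u) :
    Approx (stab D Θ) (g.prodMap LinearMap.id) h (f.coprod θ) where
  inj_left := A.inj_left.prodMap Function.injective_id
  inj_right := A.inj_right
  comm e := by simp [FredDet.stab, A.comm, hθ]
  exists_preimage x b hx := by
    obtain ⟨e, he⟩ := A.exists_preimage x.1 (b - θ x.2) (by
      rw [map_sub, ← hx, hθ]
      simp [FredDet.stab])
    exact ⟨(e, x.2), Prod.ext he rfl⟩
  transverse y := by
    obtain ⟨x, b, hy⟩ := A.transverse y
    exact ⟨(x, 0), b, by simpa [FredDet.stab] using hy⟩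

variable [FiniteDimensional ℝ E]

-- The kernel is zero, so a whole basis of `E` plays the role of `p`, and `Ω_N` represents the
-- generator of the cokernel line. The sign of `red` has exponent `dim E (dim E + N + 1)`, congruent
-- to `N dim E`.
set_option maxHeartbeats 1000000 in
theorem red_incl (hg : Function.Injective g) {α : Lam E} (hα : α ≠ 0) :
    (approx_incl (N := N) hg).fourTerm.red
        (α ⊗ₜ dualElt (isSES_inl_snd.wedge α (vol N))) =
      (-1 : ℝ) ^ (Module.finrank ℝ E * N) •
        (lamOne (Ker (incl X N)) finrank_ker_incl ⊗ₜ
          (dualElt (vol N) ∘ₗ lamMap (cokIncl X N))) := by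
  obtain ⟨a, ha⟩ := exists_lamList_ne_zero (V := E)
  have hal := length_of_lamList_ne_zero ha
  set ω : List (Fin N → ℝ) := List.ofFn fun k : Fin N => (Pi.single k (1 : ℝ) : Fin N → ℝ)
    with hω
  have hvol : vol N = lamList ((ω.map (LinearMap.inr ℝ E _)).map (LinearMap.snd ℝ E _)) := by
    rw [vol_eq_lamList, List.map_map]
    exact congrArg lamList (List.map_id _).symm
  have hw : isSES_inl_snd.wedge (lamList a) (vol N) =
      lamList (a.map (LinearMap.inl ℝ E (Fin N → ℝ)) ++ ω.map (LinearMap.inr ℝ E _)) := by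
    rw [hvol, isSES_inl_snd.wedge_lamList hal]
  have hw0 := isSES_inl_snd.wedge_ne_zero ha (vol_ne_zero N)
  have hlist : (lamList a ⊗ₜ[ℝ] dualElt (isSES_inl_snd.wedge (lamList a) (vol N))) =
      (lamList ([].map (approx_incl (N := N) hg).kerMap ++ a) ⊗ₜ[ℝ]
        dualElt (lamList (a.map (LinearMap.inl ℝ E (Fin N → ℝ)) ++
          ω.map (LinearMap.inr ℝ E _)))) := by
    rw [hw]; rfl
  have hcok : dualElt (lamList ((ω.map (LinearMap.inr ℝ E _)).map
      (approx_incl (X := X) (N := N) hg).cokMap)) = dualElt (vol N) ∘ₗ lamMap (cokIncl X N) := by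
    have := (approx_incl (X := X) (N := N) hg).fourTerm.finite_right
    symm
    apply dualElt_unique finrank_lam
    rw [LinearMap.comp_apply, lamMap_lamList, List.map_map, List.map_map]
    convert dualElt_self (vol_ne_zero N)
    rw [vol_eq_lamList]
    exact congrArg lamList (List.map_id _)
  have key : (approx_incl (N := N) hg).fourTerm.red
      (lamList a ⊗ₜ dualElt (isSES_inl_snd.wedge (lamList a) (vol N))) =
      (-1 : ℝ) ^ (Module.finrank ℝ E * N) •
        (lamOne (Ker (incl X N)) finrank_ker_incl ⊗ₜ
          (dualElt (vol N) ∘ₗ lamMap (cokIncl X N))) := by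
    rw [hlist, (approx_incl (N := N) hg).fourTerm.red_lamList (x := [])
      finrank_ker_incl.symm ha
      (by rwa [hw] at hw0), hcok, lamOne_eq_lamList, hal, Module.finrank_prod]
    congr 1
    rw [Module.finrank_fin_fun]
    apply neg_one_pow_congr
    push_cast
    generalize (Module.finrank ℝ E : ZMod 2) = a1
    generalize (N : ZMod 2) = a2
    revert a1 a2
    decide
  obtain ⟨c, rfl⟩ := eq_smul_of_line finrank_lam ha α
  have hc := left_ne_zero_of_smul hα
  rw [map_smul, LinearMap.smul_apply, dualElt_smul finrank_lam hw0 hc, TensorProduct.tmul_smul,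
    ← TensorProduct.smul_tmul', smul_smul, inv_mul_cancel₀ hc, one_smul, key]

set_option maxHeartbeats 1000000 in
/-- In terms of restrictions to finite-dimensional spaces, the stabilization isomorphism is
`(α ∧ Ω_N) ⊗ β^* ↦ (-1)^{N dim E} α ⊗ β^*`. -/
theorem stabMap_red [FiniteDimensional ℝ F] (A : Approx D g h f) (hD : D.IsFredholm)
    {Θ : (Fin N → ℝ) →L[ℝ] Y} {θ : (Fin N → ℝ) →ₗ[ℝ] F} (hθ : ∀ u, h (θ u) = Θ u) {α : Lam E}
    {β : Lam F} (hα : α ≠ 0) (hβ : β ≠ 0) :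
    stabMap D hD Θ ((A.stab hθ).fourTerm.red (isSES_inl_snd.wedge α (vol N) ⊗ₜ dualElt β)) =
      (-1 : ℝ) ^ (Module.finrank ℝ E * N) • A.fourTerm.red (α ⊗ₜ dualElt β) := by
  have hw := isSES_inl_snd.wedge_ne_zero hα (vol_ne_zero N)
  -- Read backwards, the contraction inserts `α ∧ Ω_N` as the intermediate generator; its first
  -- factor is then evaluated by `red_incl`, whose sign cancels the one in the statement.
  rw [← compMap_red (stab_comp_incl D Θ) isFredholm_incl (isFredholm_stab hD Θ)
    (approx_incl A.inj_left) (A.stab hθ) A hw hβ, red_incl A.inj_left hα,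
    ← TensorProduct.smul_tmul', map_smul, smul_smul, ← mul_pow]
  simp [stabMap]

end Stabilization

/-! ### Wedge products of direct sums of short exact sequences -/

section Products

variable {V' V V'' W' W W'' : Type*} [AddCommGroup V'] [Module ℝ V'] [AddCommGroup V] [Module ℝ V]
  [AddCommGroup V''] [Module ℝ V''] [AddCommGroup W'] [Module ℝ W'] [AddCommGroup W] [Module ℝ W]
  [AddCommGroup W''] [Module ℝ W''] {i : V' →ₗ[ℝ] V} {j : V →ₗ[ℝ] V''} {k : W' →ₗ[ℝ] W}
  {l : W →ₗ[ℝ] W''}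

theorem IsSES.prodMap (h₁ : IsSES i j) (h₂ : IsSES k l) : IsSES (i.prodMap k) (j.prodMap l) where
  inj := h₁.inj.prodMap h₂.inj
  exact := by
    rintro ⟨a, b⟩
    constructor
    · intro hab
      obtain ⟨x, hx⟩ := (h₁.exact a).1 (congrArg Prod.fst hab)
      obtain ⟨y, hy⟩ := (h₂.exact b).1 (congrArg Prod.snd hab)
      exact ⟨(x, y), Prod.ext hx hy⟩
    · rintro ⟨⟨x, y⟩, hxy⟩
      rw [← hxy]
      exact Prod.ext (h₁.exact.apply_apply_eq_zero x) (h₂.exact.apply_apply_eq_zero y)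
  surj := h₁.surj.prodMap h₂.surj

theorem wedge_inl_snd_lamList [FiniteDimensional ℝ V] [FiniteDimensional ℝ W] {x : List V}
    (hx : lamList x ≠ 0) (y : List W) : isSES_inl_snd.wedge (lamList x) (lamList y) =
      lamList (x.map (LinearMap.inl ℝ V W) ++ y.map (LinearMap.inr ℝ V W)) := by
  rw [← isSES_inl_snd.wedge_lamList (length_of_lamList_ne_zero hx), List.map_map]
  exact congrArg (fun z => isSES_inl_snd.wedge (lamList x) (lamList z)) (List.map_id y).symm

/-- The sign is that of moving `b'` past the lifts of `a''`. It is the source of the term `N' dim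
E''` for the stabilized triple. -/
theorem IsSES.wedge_prodMap [FiniteDimensional ℝ V'] [FiniteDimensional ℝ V]
    [FiniteDimensional ℝ V''] [FiniteDimensional ℝ W'] [FiniteDimensional ℝ W]
    [FiniteDimensional ℝ W''] (h₁ : IsSES i j) (h₂ : IsSES k l) (a' : Lam V') (a'' : Lam V'')
    (b' : Lam W') (b'' : Lam W'') :
    (h₁.prodMap h₂).wedge (isSES_inl_snd.wedge a' b') (isSES_inl_snd.wedge a'' b'') =
      (-1 : ℝ) ^ (Module.finrank ℝ W' * Module.finrank ℝ V'') •
        isSES_inl_snd.wedge (h₁.wedge a' a'') (h₂.wedge b' b'') := by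
  obtain ⟨x', hx'⟩ := exists_lamList_ne_zero (V := V')
  obtain ⟨x'', hx''⟩ := exists_lamList_map_ne_zero h₁.surj
  obtain ⟨y', hy'⟩ := exists_lamList_ne_zero (V := W')
  obtain ⟨y'', hy''⟩ := exists_lamList_map_ne_zero h₂.surj
  have e' := wedge_inl_snd_lamList hx' y'
  have e'' : isSES_inl_snd.wedge (lamList (x''.map j)) (lamList (y''.map l)) =
      lamList ((x''.map (LinearMap.inl ℝ V W) ++ y''.map (LinearMap.inr ℝ V W)).map
        (j.prodMap l)) := by
    rw [wedge_inl_snd_lamList hx'']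
    simp only [List.map_append, List.map_map]
    congr 2
    · exact List.map_congr_left fun a _ => Prod.ext rfl (map_zero l).symm
    · exact List.map_congr_left fun a _ => Prod.ext (map_zero j).symm rfl
  have hl' := length_of_lamList_ne_zero (e' ▸ isSES_inl_snd.wedge_ne_zero hx' hy')
  have key : (h₁.prodMap h₂).wedge (isSES_inl_snd.wedge (lamList x') (lamList y'))
      (isSES_inl_snd.wedge (lamList (x''.map j)) (lamList (y''.map l))) =
      (-1 : ℝ) ^ (Module.finrank ℝ W' * Module.finrank ℝ V'') •
        isSES_inl_snd.wedge (h₁.wedge (lamList x') (lamList (x''.map j)))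
          (h₂.wedge (lamList y') (lamList (y''.map l))) := by
    have hx0 := h₁.lamList_append_ne_zero hx' hx''
    rw [e', e'', (h₁.prodMap h₂).wedge_lamList hl',
      h₁.wedge_lamList (length_of_lamList_ne_zero hx'),
      h₂.wedge_lamList (length_of_lamList_ne_zero hy'), wedge_inl_snd_lamList hx0]
    have c1 : (x'.map (LinearMap.inl ℝ V' W')).map (i.prodMap k) =
        (x'.map i).map (LinearMap.inl ℝ V W) := by
      rw [List.map_map, List.map_map]
      exact List.map_congr_left fun a _ => Prod.ext rfl (map_zero k)
    have c2 : (y'.map (LinearMap.inr ℝ V' W')).map (i.prodMap k) =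
        (y'.map k).map (LinearMap.inr ℝ V W) := by
      rw [List.map_map, List.map_map]
      exact List.map_congr_left fun a _ => Prod.ext (map_zero i) rfl
    simp only [List.map_append, List.append_assoc, c1, c2]
    rw [lamList_swap]
    congr 2
    rw [← length_of_lamList_ne_zero hy', ← length_of_lamList_ne_zero hx'']
    simp only [List.length_map]
  obtain ⟨c1, rfl⟩ := eq_smul_of_line finrank_lam hx' a'
  obtain ⟨c2, rfl⟩ := eq_smul_of_line finrank_lam hx'' a''
  obtain ⟨c3, rfl⟩ := eq_smul_of_line finrank_lam hy' b'
  obtain ⟨c4, rfl⟩ := eq_smul_of_line finrank_lam hy'' b''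
  simp only [map_smul, LinearMap.smul_apply, key, smul_smul]
  congr 1
  ring

end Products

/-! ### Comparing maps on generators of lines -/

section Lines

theorem comp_eq_smul_comp_map {P' P'' P Q' Q'' Q : Type*} [AddCommGroup P'] [Module ℝ P']
    [AddCommGroup P''] [Module ℝ P''] [AddCommGroup P] [Module ℝ P] [AddCommGroup Q'] [Module ℝ Q']
    [AddCommGroup Q''] [Module ℝ Q''] [AddCommGroup Q] [Module ℝ Q]
    (hP' : Module.finrank ℝ P' = 1) (hP'' : Module.finrank ℝ P'' = 1)
    {Φ : P' ⊗[ℝ] P'' →ₗ[ℝ] P} {Ψ : Q' ⊗[ℝ] Q'' →ₗ[ℝ] Q} {I : P →ₗ[ℝ] Q} {I' : P' →ₗ[ℝ] Q'}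
    {I'' : P'' →ₗ[ℝ] Q''} {p' : P'} {p'' : P''} {p : P} {q' : Q'} {q'' : Q''} {q : Q}
    {a b c' c'' d e : ℝ} (hp' : p' ≠ 0) (hp'' : p'' ≠ 0) (h₁ : Φ (p' ⊗ₜ p'') = a • p)
    (h₂ : I p = b • q) (h₃ : I' p' = c' • q') (h₄ : I'' p'' = c'' • q'')
    (h₅ : Ψ (q' ⊗ₜ q'') = d • q) (h : a * b = e * (c' * c'' * d)) :
    I ∘ₗ Φ = e • (Ψ ∘ₗ TensorProduct.map I' I'') := by
  refine TensorProduct.ext' fun x y => ?_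
  obtain ⟨r, rfl⟩ := eq_smul_of_line hP' hp' x
  obtain ⟨r', rfl⟩ := eq_smul_of_line hP'' hp'' y
  simp only [← TensorProduct.smul_tmul', TensorProduct.tmul_smul, map_smul]
  congr 2
  simp only [LinearMap.comp_apply, LinearMap.smul_apply, TensorProduct.map_tmul, h₁, h₂, h₃, h₄,
    ← TensorProduct.smul_tmul', TensorProduct.tmul_smul, map_smul, h₅, smul_smul]
  rw [h]
  congr 1
  ring

end Lines

/-! ### Dimension count in a four-term sequence -/

section FourTerm

variable {K E F C : Type*} [AddCommGroup K] [Module ℝ K] [AddCommGroup E] [Module ℝ E]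
  [AddCommGroup F] [Module ℝ F] [AddCommGroup C] [Module ℝ C]
  {l : K →ₗ[ℝ] E} {f : E →ₗ[ℝ] F} {q : F →ₗ[ℝ] C}

/-- For an approximation of `D` this says `ind D = dim E - dim F`, written without subtraction. -/
theorem FourTerm.finrank_eq (S : FourTerm l f q) [FiniteDimensional ℝ E] [FiniteDimensional ℝ F] :
    Module.finrank ℝ K + Module.finrank ℝ F = Module.finrank ℝ E + Module.finrank ℝ C := by
  have h1 := S.ses_left.finrank_eq
  have h2 := S.ses_right.finrank_eq
  omega

theorem FourTerm.finite (S : FourTerm l f q) [FiniteDimensional ℝ K] [FiniteDimensional ℝ F] :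
    FiniteDimensional ℝ E := by
  have : FiniteDimensional ℝ (LinearMap.ker f) := by
    rw [S.exact_left.linearMap_ker_eq]
    infer_instance
  have : FiniteDimensional ℝ (E ⧸ LinearMap.ker f) :=
    Module.Finite.equiv f.quotKerEquivRange.symm
  exact Module.Finite.of_submodule_quotient (LinearMap.ker f)

end FourTerm

/-! ### The identity for a given approximation -/

section Stabilization

variable {X' X X'' Y' Y Y'' : Type*}
  [NormedAddCommGroup X'] [NormedSpace ℝ X'] [NormedAddCommGroup X] [NormedSpace ℝ X]
  [NormedAddCommGroup X''] [NormedSpace ℝ X''] [NormedAddCommGroup Y'] [NormedSpace ℝ Y']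
  [NormedAddCommGroup Y] [NormedSpace ℝ Y] [NormedAddCommGroup Y''] [NormedSpace ℝ Y'']
  {t : FredTriple X' X X'' Y' Y Y''}
  {E' E E'' F' F F'' : Type*} [AddCommGroup E'] [Module ℝ E'] [AddCommGroup E] [Module ℝ E]
  [AddCommGroup E''] [Module ℝ E''] [AddCommGroup F'] [Module ℝ F'] [AddCommGroup F] [Module ℝ F]
  [AddCommGroup F''] [Module ℝ F'']
  {g' : E' →ₗ[ℝ] X'} {h' : F' →ₗ[ℝ] Y'} {f' : E' →ₗ[ℝ] F'}
  {g : E →ₗ[ℝ] X} {h : F →ₗ[ℝ] Y} {f : E →ₗ[ℝ] F}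
  {g'' : E'' →ₗ[ℝ] X''} {h'' : F'' →ₗ[ℝ] Y''} {f'' : E'' →ₗ[ℝ] F''}
  {iE : E' →ₗ[ℝ] E} {jE : E →ₗ[ℝ] E''} {iF : F' →ₗ[ℝ] F} {jF : F →ₗ[ℝ] F''}
  {N' N N'' : ℕ} {s : StabTriple t N' N N''}
  {θ' : (Fin N' → ℝ) →ₗ[ℝ] F'} {θ : (Fin N → ℝ) →ₗ[ℝ] F} {θ'' : (Fin N'' → ℝ) →ₗ[ℝ] F''}

namespace ApproxTriple

theorem stab (T : ApproxTriple t g' h' f' g h f g'' h'' f'' iE jE iF jF)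
    (hθ' : ∀ u, h' (θ' u) = s.Θ' u) (hθ : ∀ u, h (θ u) = s.Θ u)
    (hθ'' : ∀ u, h'' (θ'' u) = s.Θ'' u) :
    ApproxTriple (stabTriple t s) (g'.prodMap LinearMap.id) h' (f'.coprod θ')
      (g.prodMap LinearMap.id) h (f.coprod θ) (g''.prodMap LinearMap.id) h'' (f''.coprod θ'')
      (iE.prodMap s.i.toLinearMap) (jE.prodMap s.j.toLinearMap) iF jF where
  approx' := T.approx'.stab hθ'
  approx := T.approx.stab hθ
  approx'' := T.approx''.stab hθ''
  sesE := T.sesE.prodMap s.ses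
  sesF := T.sesF
  comm_iE e := Prod.ext (T.comm_iE e.1) rfl
  comm_jE e := Prod.ext (T.comm_jE e.1) rfl
  comm_iF := T.comm_iF
  comm_jF := T.comm_jF

variable [FiniteDimensional ℝ E'] [FiniteDimensional ℝ E] [FiniteDimensional ℝ E'']
  [FiniteDimensional ℝ F'] [FiniteDimensional ℝ F] [FiniteDimensional ℝ F'']

set_option maxHeartbeats 1000000 in
/-- The isomorphism `Ψ` of the stabilized triple in terms of restrictions of the operators. -/
theorem psi_stab_red (T : ApproxTriple t g' h' f' g h f g'' h'' f'' iE jE iF jF)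
    (s : StabTriple t N' N N'') (hθ' : ∀ u, h' (θ' u) = s.Θ' u) (hθ : ∀ u, h (θ u) = s.Θ u)
    (hθ'' : ∀ u, h'' (θ'' u) = s.Θ'' u) (α' : Lam E') (α'' : Lam E'') {β' : Lam F'}
    {β'' : Lam F''} (hβ' : β' ≠ 0) (hβ'' : β'' ≠ 0) :
    (stabTriple t s).Psi
      ((T.approx'.stab hθ').fourTerm.red (isSES_inl_snd.wedge α' (vol N') ⊗ₜ dualElt β') ⊗ₜ
        (T.approx''.stab hθ'').fourTerm.red
          (isSES_inl_snd.wedge α'' (vol N'') ⊗ₜ dualElt β'')) =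
      ((-1 : ℝ) ^ ((Module.finrank ℝ E'' + N'' + Module.finrank ℝ F'') * Module.finrank ℝ F' +
        N' * Module.finrank ℝ E'') * s.A) •
        (T.approx.stab hθ).fourTerm.red
          (isSES_inl_snd.wedge (T.sesE.wedge α' α'') (vol N) ⊗ₜ
            dualElt (T.sesF.wedge β' β'')) := by
  have hw : (T.sesE.prodMap s.ses).wedge (isSES_inl_snd.wedge α' (vol N'))
      (isSES_inl_snd.wedge α'' (vol N'')) =
      ((-1 : ℝ) ^ (N' * Module.finrank ℝ E'') * s.A) •
        isSES_inl_snd.wedge (T.sesE.wedge α' α'') (vol N) := by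
    rw [T.sesE.wedge_prodMap s.ses, s.A_spec, map_smul, smul_smul]
    congr 2
    rw [Module.finrank_fin_fun]
  refine ((T.stab hθ' hθ hθ'').psi_red (α' := isSES_inl_snd.wedge α' (vol N'))
    (α'' := isSES_inl_snd.wedge α'' (vol N'')) hβ' hβ'').trans ?_
  rw [hw, ← TensorProduct.smul_tmul', map_smul, smul_smul, Module.finrank_prod, pow_add, mul_assoc]
  congr 4
  rw [Module.finrank_fin_fun]

-- Source lines are one-dimensional, so the identity is tested on a single generator, where the
-- formulas for the two `Ψ` and the three stabilization maps apply and only scalars remain to be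
-- compared.
set_option maxHeartbeats 2000000 in
theorem stabMap_comp_Psi (T : ApproxTriple t g' h' f' g h f g'' h'' f'' iE jE iF jF)
    (s : StabTriple t N' N N'') (hθ' : ∀ u, h' (θ' u) = s.Θ' u) (hθ : ∀ u, h (θ u) = s.Θ u)
    (hθ'' : ∀ u, h'' (θ'' u) = s.Θ'' u) :
    stabMap t.D t.fredholm s.Θ ∘ₗ (stabTriple t s).Psi =
      ((-1 : ℝ) ^ (ind t.D' * (N'' : ℤ)) * s.A) •
        (t.Psi ∘ₗ TensorProduct.map (stabMap t.D' t.fredholm' s.Θ')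
          (stabMap t.D'' t.fredholm'' s.Θ'')) := by
  obtain ⟨α', hα'⟩ := exists_ne_zero_of_line (finrank_lam (V := E'))
  obtain ⟨α'', hα''⟩ := exists_ne_zero_of_line (finrank_lam (V := E''))
  obtain ⟨β', hβ'⟩ := exists_ne_zero_of_line (finrank_lam (V := F'))
  obtain ⟨β'', hβ''⟩ := exists_ne_zero_of_line (finrank_lam (V := F''))
  have hα := T.sesE.wedge_ne_zero hα' hα''
  have hβ := T.sesF.wedge_ne_zero hβ' hβ''
  have hne' := (T.approx'.stab hθ').fourTerm.red_ne_zero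
    (tmul_ne_zero (isSES_inl_snd.wedge_ne_zero hα' (vol_ne_zero N')) (dualElt_ne_zero hβ'))
  have hne'' := (T.approx''.stab hθ'').fourTerm.red_ne_zero
    (tmul_ne_zero (isSES_inl_snd.wedge_ne_zero hα'' (vol_ne_zero N'')) (dualElt_ne_zero hβ''))
  -- The index of `D'` has the parity of `dim E' + dim F'`.
  have hsign : (-1 : ℝ) ^ (ind t.D' * (N'' : ℤ)) =
      (-1) ^ ((Module.finrank ℝ E' + Module.finrank ℝ F') * N'') := by
    apply neg_one_zpow_congr
    have h1 := congrArg (Nat.cast : ℕ → ZMod 2) T.approx'.fourTerm.finrank_eq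
    rw [ind]
    push_cast at h1 ⊢
    generalize (Module.finrank ℝ (Ker t.D') : ZMod 2) = a1 at *
    generalize (Module.finrank ℝ (Coker t.D') : ZMod 2) = a2 at *
    generalize (Module.finrank ℝ E' : ZMod 2) = a3 at *
    generalize (Module.finrank ℝ F' : ZMod 2) = a4 at *
    generalize (N'' : ZMod 2) = a5 at *
    revert a1 a2 a3 a4 a5
    decide
  refine comp_eq_smul_comp_map (P' := DetLine (FredDet.stab t.D' s.Θ'))
    (P'' := DetLine (FredDet.stab t.D'' s.Θ'')) (P := DetLine (FredDet.stab t.D s.Θ))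
    (Q' := DetLine t.D') (Q'' := DetLine t.D'') (Q := DetLine t.D) (Φ := (stabTriple t s).Psi)
    (Ψ := t.Psi) (finrank_detLine (isFredholm_stab t.fredholm' s.Θ'))
    (finrank_detLine (isFredholm_stab t.fredholm'' s.Θ'')) hne' hne''
    (T.psi_stab_red s hθ' hθ hθ'' α' α'' hβ' hβ'') (stabMap_red T.approx t.fredholm hθ hα hβ)
    (stabMap_red T.approx' t.fredholm' hθ' hα' hβ')
    (stabMap_red T.approx'' t.fredholm'' hθ'' hα'' hβ'')
    (T.psi_red (α' := α') (α'' := α'') hβ' hβ'') ?_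
  have hN := s.ses.finrank_eq
  simp only [Module.finrank_fin_fun] at hN
  rw [hsign, mul_right_comm, ← pow_add, mul_right_comm, ← pow_add, ← pow_add, ← pow_add,
    ← T.sesE.finrank_eq]
  congr 1
  rw [← hN]
  -- After `N = N' + N''` and `dim E = dim E' + dim E''`, the terms `N' dim E'`, `N' dim E''` and
  -- `N'' dim E''` cancel modulo 2, leaving `N'' dim E' + N'' dim F'`.
  apply neg_one_pow_congr
  push_cast
  generalize (Module.finrank ℝ E' : ZMod 2) = a1
  generalize (Module.finrank ℝ E'' : ZMod 2) = a2
  generalize (Module.finrank ℝ F' : ZMod 2) = a3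
  generalize (Module.finrank ℝ F'' : ZMod 2) = a4
  generalize (N' : ZMod 2) = a5
  generalize (N'' : ZMod 2) = a6
  revert a1 a2 a3 a4 a5 a6
  decide

end ApproxTriple

end Stabilization

/-! ### Existence of compatible approximations -/

section Existence

theorem exists_finite_transverse {X Y : Type*} [NormedAddCommGroup X] [NormedSpace ℝ X]
    [NormedAddCommGroup Y] [NormedSpace ℝ Y] {D : X →L[ℝ] Y} (hD : D.IsFredholm) :
    ∃ S : Submodule ℝ Y, FiniteDimensional ℝ S ∧ ∀ y, ∃ x, ∃ b ∈ S, y = D x + b := by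
  obtain ⟨S, hS⟩ := (LinearMap.range D.toLinearMap).exists_isCompl
  have : FiniteDimensional ℝ (Coker D) := hD.finite_coker
  refine ⟨S, Module.Finite.equiv (Submodule.quotientEquivOfIsCompl _ _ hS), fun y => ?_⟩
  obtain ⟨_, ⟨x, rfl⟩, b, hb, h⟩ := Submodule.mem_sup.1 (hS.sup_eq_top ▸ Submodule.mem_top (x := y))
  exact ⟨x, b, hb, h.symm⟩

/-- The restriction of an operator `D` to the preimage of a subspace transverse to `D`. -/
theorem approx_comap {X Y : Type*} [NormedAddCommGroup X] [NormedSpace ℝ X]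
    [NormedAddCommGroup Y] [NormedSpace ℝ Y] {D : X →L[ℝ] Y} {S : Submodule ℝ Y}
    (hS : ∀ y, ∃ x, ∃ b ∈ S, y = D x + b) :
    Approx D (S.comap D.toLinearMap).subtype S.subtype
      (D.toLinearMap.restrict fun _ hx => hx) where
  inj_left := Subtype.val_injective
  inj_right := Subtype.val_injective
  comm _ := rfl
  exists_preimage x b hx := ⟨⟨x, by
    rw [Submodule.mem_comap]
    exact hx ▸ b.2⟩, rfl⟩
  transverse y := by
    obtain ⟨x, b, hb, h⟩ := hS y
    exact ⟨x, ⟨b, hb⟩, h⟩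

variable {X' X X'' Y' Y Y'' : Type*}
  [NormedAddCommGroup X'] [NormedSpace ℝ X'] [NormedAddCommGroup X] [NormedSpace ℝ X]
  [NormedAddCommGroup X''] [NormedSpace ℝ X''] [NormedAddCommGroup Y'] [NormedSpace ℝ Y']
  [NormedAddCommGroup Y] [NormedSpace ℝ Y] [NormedAddCommGroup Y''] [NormedSpace ℝ Y'']
  {t : FredTriple X' X X'' Y' Y Y''} {S : Submodule ℝ Y}

/-- A diagram chase: correct `y` using `D''` and a lift so that the remainder comes from `Y'`, then
use transversality there. Thus only the outer columns have to be arranged. -/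
theorem transverse_middle (h' : ∀ y, ∃ x, ∃ b ∈ S.comap t.iY.toLinearMap, y = t.D' x + b)
    (h'' : ∀ y, ∃ x, ∃ b ∈ S.map t.jY.toLinearMap, y = t.D'' x + b) :
    ∀ y, ∃ x, ∃ b ∈ S, y = t.D x + b := by
  intro y
  obtain ⟨x'', _, ⟨b, hb, rfl⟩, hy⟩ := h'' (t.jY y)
  obtain ⟨x, rfl⟩ := t.sesX.surj x''
  obtain ⟨y', hy'⟩ := (t.sesY.exact (y - t.D x - b)).1 (by
    change t.jY (y - t.D x - b) = 0
    rw [map_sub, map_sub, t.comm_j_apply, hy]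
    simp)
  obtain ⟨x', b', hb', rfl⟩ := h' y'
  refine ⟨x + t.iX x', b + t.iY b', S.add_mem hb hb', ?_⟩
  have e : t.iY (t.D' x' + b') = y - t.D x - b := hy'
  rw [map_add, t.comm_i_apply] at e
  rw [eq_sub_iff_add_eq, eq_sub_iff_add_eq] at e
  rw [← e, map_add]
  abel

theorem approxTriple_submodule
    (h' : ∀ y, ∃ x, ∃ b ∈ S.comap t.iY.toLinearMap, y = t.D' x + b)
    (h'' : ∀ y, ∃ x, ∃ b ∈ S.map t.jY.toLinearMap, y = t.D'' x + b) :
    ApproxTriple t ((S.comap t.iY.toLinearMap).comap t.D'.toLinearMap).subtype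
      (S.comap t.iY.toLinearMap).subtype (t.D'.toLinearMap.restrict fun _ hx => hx)
      (S.comap t.D.toLinearMap).subtype S.subtype (t.D.toLinearMap.restrict fun _ hx => hx)
      ((S.map t.jY.toLinearMap).comap t.D''.toLinearMap).subtype
      (S.map t.jY.toLinearMap).subtype (t.D''.toLinearMap.restrict fun _ hx => hx)
      (t.iX.toLinearMap.restrict fun x hx => by
        have : t.iY (t.D' x) ∈ S := hx
        rwa [t.comm_i_apply] at this)
      (t.jX.toLinearMap.restrict fun x hx => ⟨t.D x, hx, t.comm_j_apply x⟩)
      (t.iY.toLinearMap.restrict fun x hx => hx)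
      (t.jY.toLinearMap.restrict fun x hx => ⟨x, hx, rfl⟩) where
  approx' := approx_comap h'
  approx := approx_comap (transverse_middle h' h'')
  approx'' := approx_comap h''
  sesE :=
    { inj := fun x y hxy => Subtype.ext (t.sesX.inj (congrArg Subtype.val hxy))
      exact := fun x => by
        constructor
        · intro hx
          obtain ⟨x', hx'⟩ := (t.sesX.exact x.1).1 (congrArg Subtype.val hx)
          refine ⟨⟨x', ?_⟩, Subtype.ext hx'⟩
          change t.iY (t.D' x') ∈ S
          rw [t.comm_i_apply]
          exact (congrArg (fun z => t.D z ∈ S) hx').mpr x.2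
        · rintro ⟨x', rfl⟩
          exact Subtype.ext (t.sesX.exact.apply_apply_eq_zero x'.1)
      surj := by
        rintro ⟨x'', b, hb, hx''⟩
        obtain ⟨x, rfl⟩ := t.sesX.surj x''
        obtain ⟨y', hy'⟩ := (t.sesY.exact (t.D x - b)).1 (by
          change t.jY (t.D x - b) = 0
          rw [map_sub, t.comm_j_apply, sub_eq_zero]
          exact hx''.symm)
        -- A lift `x` of `x''` need not satisfy `D x ∈ S`; transversality to `D'` supplies `x'` with
        -- `D (x - iX x') ∈ S`. This is what makes the row of preimages exact on the right.
        obtain ⟨x', b', hb', rfl⟩ := h' y'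
        have e : t.iY (t.D' x' + b') = t.D x - b := hy'
        rw [map_add, t.comm_i_apply] at e
        refine ⟨⟨x - t.iX x', ?_⟩, Subtype.ext ?_⟩
        · change t.D (x - t.iX x') ∈ S
          have : t.D (x - t.iX x') = b + t.iY b' := by
            rw [map_sub, sub_eq_iff_eq_add, add_assoc, add_comm (t.iY b'), e]
            abel
          rw [this]
          exact S.add_mem hb hb'
        · change t.jX (x - t.iX x') = t.jX x
          have : t.jX (t.iX x') = 0 := t.sesX.exact.apply_apply_eq_zero x'
          rw [map_sub, this, sub_zero] }
  sesF :=
    { inj := fun x y hxy => Subtype.ext (t.sesY.inj (congrArg Subtype.val hxy))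
      exact := fun x => by
        constructor
        · intro hx
          obtain ⟨x', hx'⟩ := (t.sesY.exact x.1).1 (congrArg Subtype.val hx)
          exact ⟨⟨x', (congrArg (fun z => z ∈ S) hx').mpr x.2⟩, Subtype.ext hx'⟩
        · rintro ⟨x', rfl⟩
          exact Subtype.ext (t.sesY.exact.apply_apply_eq_zero x'.1)
      surj := by
        rintro ⟨_, b, hb, rfl⟩
        exact ⟨⟨b, hb⟩, rfl⟩ }
  comm_iE _ := rfl
  comm_jE _ := rfl
  comm_iF _ := rfl
  comm_jF _ := rfl

variable {N' N N'' : ℕ}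

theorem exists_transverse_submodule (s : StabTriple t N' N N'') :
    ∃ S : Submodule ℝ Y, FiniteDimensional ℝ S ∧ (∀ u, s.Θ u ∈ S) ∧
      (∀ y, ∃ x, ∃ b ∈ S.comap t.iY.toLinearMap, y = t.D' x + b) ∧
      ∀ y, ∃ x, ∃ b ∈ S.map t.jY.toLinearMap, y = t.D'' x + b := by
  obtain ⟨S', hS', h'⟩ := exists_finite_transverse t.fredholm'
  obtain ⟨S'', hS'', h''⟩ := exists_finite_transverse t.fredholm''
  -- The first summand gives transversality to `D'`, the second, by an algebraic splitting of `jY`,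
  -- transversality to `D''`, and the third makes `Θ` take values in `S`. Enlarging `S` preserves
  -- both transversality conditions.
  refine ⟨S'.map t.iY.toLinearMap ⊔ S''.map t.sesY.lift ⊔ LinearMap.range s.Θ.toLinearMap,
    inferInstance, fun u => Submodule.mem_sup_right ⟨u, rfl⟩, fun y => ?_, fun y => ?_⟩
  · obtain ⟨x, b, hb, h⟩ := h' y
    exact ⟨x, b, Submodule.mem_sup_left (Submodule.mem_sup_left ⟨b, hb, rfl⟩), h⟩
  · obtain ⟨x, b, hb, h⟩ := h'' y
    exact ⟨x, b, ⟨t.sesY.lift b, Submodule.mem_sup_left (Submodule.mem_sup_right ⟨b, hb, rfl⟩),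
      t.sesY.section_spec b⟩, h⟩

set_option maxHeartbeats 1000000 in
theorem stabMap_comp_Psi (s : StabTriple t N' N N'') :
    stabMap t.D t.fredholm s.Θ ∘ₗ (stabTriple t s).Psi =
      ((-1 : ℝ) ^ (ind t.D' * (N'' : ℤ)) * s.A) •
        (t.Psi ∘ₗ TensorProduct.map (stabMap t.D' t.fredholm' s.Θ')
          (stabMap t.D'' t.fredholm'' s.Θ'')) := by
  obtain ⟨S, hS, hΘ, h', h''⟩ := exists_transverse_submodule s
  have T := approxTriple_submodule h' h''
  have hΘ' : ∀ u, s.Θ' u ∈ S.comap t.iY.toLinearMap := fun u => by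
    change t.iY (s.Θ' u) ∈ S
    rw [show t.iY (s.Θ' u) = s.Θ (s.i u) from DFunLike.congr_fun s.comm_i u]
    exact hΘ _
  have hΘ'' : ∀ u, s.Θ'' u ∈ S.map t.jY.toLinearMap := fun u => by
    -- Surjectivity of `j` writes `Θ'' u` as `jY (Θ v)`, so `Θ''` inherits its range condition from
    -- `Θ`.
    obtain ⟨v, rfl⟩ := s.ses.surj u
    exact ⟨s.Θ v, hΘ v, DFunLike.congr_fun s.comm_j v⟩
  have : FiniteDimensional ℝ (S.comap t.iY.toLinearMap) := Module.Finite.of_injective _ T.sesF.inj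
  -- The preimages are finite-dimensional because kernel and target both are.
  have := T.approx'.fourTerm.finite
  have := T.approx.fourTerm.finite
  have := T.approx''.fourTerm.finite
  exact T.stabMap_comp_Psi s (θ' := s.Θ'.toLinearMap.codRestrict _ hΘ')
    (θ := s.Θ.toLinearMap.codRestrict _ hΘ) (θ'' := s.Θ''.toLinearMap.codRestrict _ hΘ'')
    (fun _ => rfl) (fun _ => rfl) (fun _ => rfl)

end Existence

end FredDet

theorem mainTheorem10
    {X' X X'' Y' Y Y'' : Type*}
    [NormedAddCommGroup X'] [NormedSpace ℝ X'] [CompleteSpace X']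
    [NormedAddCommGroup X] [NormedSpace ℝ X] [CompleteSpace X]
    [NormedAddCommGroup X''] [NormedSpace ℝ X''] [CompleteSpace X'']
    [NormedAddCommGroup Y'] [NormedSpace ℝ Y'] [CompleteSpace Y']
    [NormedAddCommGroup Y] [NormedSpace ℝ Y] [CompleteSpace Y]
    [NormedAddCommGroup Y''] [NormedSpace ℝ Y''] [CompleteSpace Y'']
    (t : FredDet.FredTriple X' X X'' Y' Y Y'') (N' N N'' : ℕ)
    (s : FredDet.StabTriple t N' N N'') :
    FredDet.stabMap t.D t.fredholm s.Θ ∘ₗ (FredDet.stabTriple t s).Psi =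
      ((-1 : ℝ) ^ (FredDet.ind t.D' * (N'' : ℤ)) * s.A) •
        (t.Psi ∘ₗ TensorProduct.map (FredDet.stabMap t.D' t.fredholm' s.Θ')
          (FredDet.stabMap t.D'' t.fredholm'' s.Θ'')) := 
  FredDet.stabMap_comp_Psi s
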